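/- Let $(G_i)_{i\in I}$ be a family of finite groups, and let $G=\bigoplus_{i\in I}G_i$ be its restricted direct product, i.e. the group of all $(x_i)\in\prod_{i\in I} G_i$ with $x_i=e$ for all but finitely many $i$. For a discrete group $H$ let $\mathrm{Z}\ell^1(H)$ denote the centre of the convolution algebra $\ell^1(H)$, with the $\ell^1$-norm; for each $i$ regard $\mathrm{Z}\ell^1(G_i)$ as a subalgebra of $\mathrm{Z}\ell^1(G)$ by extending functions by zero along the inclusion $G_i\hookrightarrow G$. Let $\omega:\mathrm{Z}\ell^1(G)\to\mathbb{C}$ be an algebra character, i.e. a non-zero multiplicative linear functional. Then there is a unique family $(\chi_i)_{i\in I}$, with $\chi_i$ the (unnormalized) character of an irreducible finite-dimensional complex representation of $G_i$, such that for all $i\in I$ $$\omega(f)=\sum_{x\in G_i} f(x)\,d_{\chi_i}^{-1}\chi_i(x^{-1})\qquad\text{for all } f\in \mathrm{Z}\ell^1(G_i),$$ where $d_{\chi_i}=\chi_i(e)$ is the degree of $\chi_i$. Moreover, for this family, the ideal $\ker\omega$ has a bounded approximate identity (a norm-bounded net $(h_\alpha)$ in $\ker\omega$ with $h_\alpha *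 f\to f$ in norm for every $f\in\ker\omega$) if and only if $$d_{\chi_i}\,\|\chi_i\|_1=|G_i|\quad\text{for all but finitely many } i\in I,$$ where $\|\chi_i\|_1=\sum_{x\in G_i}|\chi_i(x)|$. -/

import Mathlib

open Filter Topology

noncomputable section

/-- The Banach space `ℓ¹(G)` of absolutely summable complex functions on a discrete group `G`. -/
abbrev EllOne (G : Type*) : Type _ := lp (fun _ : G => ℂ) 1

namespace EllOne

variable {G : Type*}

theorem memlp_iff (f : G → ℂ) : Memℓp f 1 ↔ Summable fun x => ‖f x‖ := by
  rw [memℓp_gen_iff (by simp)]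
  simp

theorem summable_norm (f : EllOne G) : Summable fun x => ‖f x‖ :=
  (memlp_iff _).1 f.2

theorem norm_eq (f : EllOne G) : ‖f‖ = ∑' x, ‖f x‖ := by
  rw [lp.norm_eq_tsum_rpow (by simp)]
  simp

open Classical in
/-- The unit point mass at `g`. -/
def delta (g : G) : EllOne G := lp.single 1 g (1 : ℂ)

open Classical in
theorem delta_apply (g x : G) : delta g x = if x = g then 1 else 0 := by
  unfold delta
  simp [lp.single_apply, Pi.single_apply]

variable [Group G]

/-- The equivalence `(y, x) ↦ (y, y * x)` of `G × G`. -/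
def shear (G : Type*) [Group G] : G × G ≃ G × G where
  toFun p := (p.1, p.1 * p.2)
  invFun p := (p.1, p.1⁻¹ * p.2)
  left_inv p := by simp
  right_inv p := by simp

theorem summable_prod (f g : EllOne G) :
    Summable fun p : G × G => ‖f p.1 * g (p.1⁻¹ * p.2)‖ := by
  have h : Summable fun p : G × G => ‖f p.1 * g p.2‖ := by
    simp only [norm_mul]
    exact (summable_norm f).mul_of_nonneg (summable_norm g)
      (fun _ => norm_nonneg _) (fun _ => norm_nonneg _)
  rw [← (shear G).summable_iff]
  refine h.congr fun p => ?_
  simp [shear]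

theorem summable_conv (f g : EllOne G) (x : G) : Summable fun y => f y * g (y⁻¹ * x) :=
  Summable.of_norm (((Equiv.prodComm G G).summable_iff.2 (summable_prod f g)).prod_factor x)

/-- Convolution: `(f * g)(x) = ∑_y f(y) g(y⁻¹x)`. -/
instance : Mul (EllOne G) where
  mul f g := ⟨fun x => ∑' y, f y * g (y⁻¹ * x), by
    have h := (Equiv.prodComm G G).summable_iff.2 (summable_prod f g)
    refine (memlp_iff _).2 (Summable.of_nonneg_of_le (fun _ => norm_nonneg _) (fun x => ?_) h.prod)
    exact norm_tsum_le_tsum_norm (h.prod_factor x)⟩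

theorem mul_apply (f g : EllOne G) (x : G) : (f * g) x = ∑' y, f y * g (y⁻¹ * x) := rfl

theorem mul_norm_le (f g : EllOne G) : ‖f * g‖ ≤ ‖f‖ * ‖g‖ := by
  have h0 := summable_prod f g
  have h := (Equiv.prodComm G G).summable_iff.2 h0
  calc ‖f * g‖ = ∑' x, ‖(f * g) x‖ := norm_eq _
    _ ≤ ∑' x, ∑' y, ‖f y * g (y⁻¹ * x)‖ :=
        (summable_norm (f * g)).tsum_le_tsum (fun x => norm_tsum_le_tsum_norm (h.prod_factor x)) h.prod
    _ = ∑' y, ∑' x, ‖f y * g (y⁻¹ * x)‖ := Summable.tsum_comm h0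
    _ = ∑' y, ‖f y‖ * ‖g‖ := by
        refine tsum_congr fun y => ?_
        simp only [norm_mul]
        rw [tsum_mul_left, norm_eq g]
        congr 1
        exact (Equiv.mulLeft y⁻¹).tsum_eq fun x => ‖g x‖
    _ = ‖f‖ * ‖g‖ := by rw [tsum_mul_right, norm_eq f]

/-- The identity is the unit point mass at the identity of the group. -/
instance : One (EllOne G) := ⟨delta 1⟩

theorem one_def : (1 : EllOne G) = delta 1 := rfl

theorem mul_delta_apply (f : EllOne G) (g x : G) : (f * delta g) x = f (x * g⁻¹) := by
  rw [mul_apply, tsum_eq_single (x * g⁻¹)]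
  · simp [delta_apply]
  · intro y hy
    rw [delta_apply, if_neg, mul_zero]
    rintro rfl
    exact hy (by group)

theorem delta_mul_apply (f : EllOne G) (g x : G) : (delta g * f) x = f (g⁻¹ * x) := by
  rw [mul_apply, tsum_eq_single g]
  · simp [delta_apply]
  · intro y hy
    rw [delta_apply, if_neg hy, zero_mul]

theorem mul_assoc' (f g h : EllOne G) : f * g * h = f * (g * h) := by
  ext x
  simp only [mul_apply]
  have hs : Summable fun p : G × G => f p.1 * g (p.1⁻¹ * p.2) * h (p.2⁻¹ * x) := by
    refine Summable.of_norm_bounded ((summable_prod f g).mul_right ‖h‖) fun p => ?_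
    rw [norm_mul]
    exact mul_le_mul_of_nonneg_left (lp.norm_apply_le_norm one_ne_zero h _) (norm_nonneg _)
  calc ∑' y, (∑' z, f z * g (z⁻¹ * y)) * h (y⁻¹ * x)
      = ∑' y, ∑' z, f z * g (z⁻¹ * y) * h (y⁻¹ * x) := by
        simp only [tsum_mul_right]
    _ = ∑' z, ∑' y, f z * g (z⁻¹ * y) * h (y⁻¹ * x) := Summable.tsum_comm hs
    _ = ∑' z, f z * ∑' w, g w * h (w⁻¹ * (z⁻¹ * x)) := by
        refine tsum_congr fun z => ?_
        rw [← tsum_mul_left, ← (Equiv.mulLeft z).tsum_eq]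
        refine tsum_congr fun w => ?_
        simp [mul_assoc]

/-- `ℓ¹(G)` with convolution is a unital Banach algebra. -/
instance : NormedRing (EllOne G) where
  __ := (inferInstance : NormedAddCommGroup (EllOne G))
  left_distrib f g h := by
    ext x
    simp only [mul_apply, lp.coeFn_add, Pi.add_apply, mul_add]
    exact (summable_conv f g x).tsum_add (summable_conv f h x)
  right_distrib f g h := by
    ext x
    simp only [mul_apply, lp.coeFn_add, Pi.add_apply, add_mul]
    exact (summable_conv f h x).tsum_add (summable_conv g h x)
  zero_mul f := by ext x; simp [mul_apply]
  mul_zero f := by ext x; simp [mul_apply]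
  mul_assoc := mul_assoc'
  one_mul f := by ext x; rw [one_def, delta_mul_apply]; simp
  mul_one f := by ext x; rw [one_def, mul_delta_apply]; simp
  norm_mul_le := mul_norm_le

instance : NormedAlgebra ℂ (EllOne G) where
  __ := Algebra.ofModule
    (fun (c : ℂ) (f g : EllOne G) => by
      ext x
      simp only [mul_apply, lp.coeFn_smul, Pi.smul_apply, smul_eq_mul, mul_assoc, tsum_mul_left])
    (fun (c : ℂ) (f g : EllOne G) => by
      ext x
      simp only [mul_apply, lp.coeFn_smul, Pi.smul_apply, smul_eq_mul, mul_left_comm _ c,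
        tsum_mul_left])
  norm_smul_le c f := norm_smul_le c f

end EllOne

/-- `Zℓ¹(G)`, the centre of the convolution algebra `ℓ¹(G)`, with the norm of `ℓ¹(G)`. -/
abbrev ZEllOne (G : Type*) [Group G] : Subalgebra ℂ (EllOne G) := Subalgebra.center ℂ (EllOne G)

namespace EllOne

variable {G H : Type*} [Group G] [Group H]

theorem mem_center_iff (f : EllOne G) :
    f ∈ ZEllOne G ↔ ∀ x g : G, f (g * x * g⁻¹) = f x := by
  rw [Subalgebra.mem_center_iff]
  constructor
  · intro h x g
    have h1 := congrArg (fun F : EllOne G => F (g * x)) (h (delta g))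
    simp only [mul_delta_apply, delta_mul_apply] at h1
    simpa using h1.symm
  · intro h k
    ext x
    rw [mul_apply, mul_apply, ← ((Equiv.inv G).trans (Equiv.mulLeft x)).tsum_eq,
      ← (MulAut.conj x).toEquiv.tsum_eq fun y => f y * k (y⁻¹ * x)]
    refine tsum_congr fun w => ?_
    simp only [Equiv.trans_apply, Equiv.inv_apply, Equiv.coe_mulLeft, MulEquiv.toEquiv_eq_coe,
      MulEquiv.coe_toEquiv, MulAut.conj_apply, h]
    rw [mul_comm]
    congr 2 <;> group

/-- Extension by zero along an injective group homomorphism, `ℓ¹(H) → ℓ¹(G)`. -/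
def extend (φ : H →* G) (hφ : Function.Injective φ) : EllOne H →ₐ[ℂ] EllOne G :=
  AlgHom.ofLinearMap
    { toFun := fun f => ⟨Function.extend φ f 0, by
        refine (memlp_iff _).2 ((hφ.summable_iff fun x hx => ?_).1 ?_)
        · simp [Function.extend_apply' _ _ _ hx]
        · simpa [Function.comp_def, hφ.extend_apply] using summable_norm f⟩
      map_add' := fun f g => by
        ext x
        change Function.extend φ (fun a => f a + g a) 0 x
          = Function.extend φ f 0 x + Function.extend φ g 0 x
        by_cases hx : ∃ a, φ a = x
        · obtain ⟨a, rfl⟩ := hx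
          simp only [hφ.extend_apply]
        · simp [Function.extend_apply' _ _ _ hx]
      map_smul' := fun c f => by
        ext x
        by_cases hx : ∃ a, φ a = x
        · obtain ⟨a, rfl⟩ := hx
          simp [hφ.extend_apply]
        · simp [Function.extend_apply' _ _ _ hx] }
    (by
      ext x
      by_cases hx : ∃ a, φ a = x
      · obtain ⟨a, rfl⟩ := hx
        simp only [LinearMap.coe_mk, AddHom.coe_mk, hφ.extend_apply, one_def, delta_apply]
        have h : φ a = 1 ↔ a = 1 := map_eq_one_iff φ hφ
        by_cases ha : a = 1
        · rw [if_pos ha, if_pos (h.2 ha)]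
        · rw [if_neg ha, if_neg fun h1 => ha (h.1 h1)]
      · have : x ≠ 1 := fun h => hx ⟨1, by simp [h]⟩
        simp [Function.extend_apply' _ _ _ hx, one_def, delta_apply, this])
    (fun f g => by
      ext x
      simp only [LinearMap.coe_mk, AddHom.coe_mk, mul_apply]
      by_cases hx : ∃ a, φ a = x
      · obtain ⟨a, rfl⟩ := hx
        rw [hφ.extend_apply, mul_apply, ← hφ.tsum_eq]
        · refine tsum_congr fun b => ?_
          rw [hφ.extend_apply, ← map_inv, ← map_mul, hφ.extend_apply]
        · intro y hy
          by_contra h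
          exact hy (by simp [Function.extend_apply' _ _ _ h])
      · rw [Function.extend_apply' _ _ _ hx, Pi.zero_apply, eq_comm]
        convert tsum_zero with y
        by_cases hy : ∃ b, φ b = y
        · obtain ⟨b, rfl⟩ := hy
          rw [Function.extend_apply' _ _ ((φ b)⁻¹ * x), Pi.zero_apply,
            mul_zero]
          rintro ⟨c, hc⟩
          exact hx ⟨b * c, by simp [hc]⟩
        · simp [Function.extend_apply' _ _ _ hy])

theorem extend_apply (φ : H →* G) (hφ : Function.Injective φ) (f : EllOne H) (x : G) :
    extend φ hφ f x = Function.extend φ f 0 x := rfl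

end EllOne

/-- The restricted direct product of a family of groups: the subgroup of `∏ i, G i` of all families
with all but finitely many entries equal to the identity. -/
def RDP {I : Type*} (G : I → Type*) [∀ i, Group (G i)] : Subgroup (∀ i, G i) where
  carrier := {x | ∀ᶠ i in cofinite, x i = 1}
  one_mem' := show ∀ᶠ _ in cofinite, _ from Eventually.of_forall fun _ => rfl
  mul_mem' := fun {x y} (hx : ∀ᶠ i in cofinite, x i = 1) (hy : ∀ᶠ i in cofinite, y i = 1) =>
    show ∀ᶠ i in cofinite, x i * y i = 1 by
      filter_upwards [hx, hy] with i h1 h2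
      rw [h1, h2, mul_one]
  inv_mem' := fun {x} (hx : ∀ᶠ i in cofinite, x i = 1) =>
    show ∀ᶠ i in cofinite, (x i)⁻¹ = 1 by
      filter_upwards [hx] with i h1
      rw [h1, inv_one]

namespace RDP

variable {I : Type*} {G : I → Type*} [∀ i, Group (G i)]

open Classical in
/-- The inclusion of the factor `G i`. -/
def incl (i : I) : G i →* RDP G :=
  (MonoidHom.mulSingle G i).codRestrict (RDP G) fun a =>
    (Set.finite_singleton i).subset fun j hj => by
      by_contra h
      exact hj (Pi.mulSingle_eq_of_ne h a)

theorem incl_same (i : I) (a : G i) : (incl i a : ∀ j, G j) i = a := by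
  classical exact Pi.mulSingle_eq_same i a

theorem incl_ne {i j : I} (h : j ≠ i) (a : G i) : (incl i a : ∀ j, G j) j = 1 := by
  classical exact Pi.mulSingle_eq_of_ne h a

theorem incl_injective (i : I) : Function.Injective (incl (G := G) i) := fun a b h => by
  rw [← incl_same i a, h, incl_same]

theorem incl_conj (i : I) (a : G i) (g : RDP G) :
    g * incl i a * g⁻¹ = incl i ((g : ∀ j, G j) i * a * ((g : ∀ j, G j) i)⁻¹) := by
  ext j
  by_cases h : j = i
  · subst h
    simp [incl_same]
  · simp [incl_ne h]

/-- The inclusion `Zℓ¹(G i) → Zℓ¹(⨁ G)` sending `a` to `a ⊗ δ_e`, i.e. extending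
a function on the factor `G i` by zero. -/
def zincl (i : I) : ZEllOne (G i) →ₐ[ℂ] ZEllOne (RDP G) :=
  ((EllOne.extend (incl i) (incl_injective i)).comp (ZEllOne (G i)).val).codRestrict
    (ZEllOne (RDP G)) fun f => by
      rw [EllOne.mem_center_iff]
      intro x g
      have hf := (EllOne.mem_center_iff _).1 f.2
      simp only [AlgHom.comp_apply, EllOne.extend_apply, Subalgebra.coe_val]
      by_cases hx : ∃ a, incl i a = x
      · obtain ⟨a, rfl⟩ := hx
        rw [incl_conj, (incl_injective i).extend_apply, (incl_injective i).extend_apply, hf]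
      · rw [Function.extend_apply' _ _ _ hx, Function.extend_apply']
        · rfl
        · rintro ⟨a, ha⟩
          refine hx ⟨((g⁻¹ : RDP G) : ∀ j, G j) i * a * (((g⁻¹ : RDP G) : ∀ j, G j) i)⁻¹, ?_⟩
          rw [← incl_conj, ha]
          group

end RDP

/-- `χ` is an irreducible group character: the (unnormalized) trace of an irreducible
finite-dimensional complex representation. Its degree is `χ 1`. -/
def IsIrreducibleCharacter {H : Type*} [Group H] (χ : H → ℂ) : Prop :=
  ∃ (n : ℕ) (ρ : Representation ℂ H (Fin n → ℂ)), ρ.IsIrreducible ∧ ρ.character = χ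

/-- `χ` is the irreducible group character of the finite group `H` corresponding to the algebra
character `ψ` of `Zℓ¹(H)`. -/
def CharacterCorresponds {H : Type*} [Group H] [Fintype H] (ψ : ZEllOne H →ₐ[ℂ] ℂ)
    (χ : H → ℂ) : Prop :=
  IsIrreducibleCharacter χ ∧
    ∀ f : ZEllOne H, ψ f = ∑ x : H, (f : EllOne H) x * ((χ 1)⁻¹ * χ x⁻¹)

/-- `χ` is the family of irreducible group characters corresponding to the algebra character `ω`
of `Zℓ¹(⨁ G)`: each `χ i` corresponds to the restriction of `ω` to `Zℓ¹(G i)`. -/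
def FamilyCorresponds {I : Type*} {G : I → Type*} [∀ i, Group (G i)] [∀ i, Fintype (G i)]
    (ω : ZEllOne (RDP G) →ₐ[ℂ] ℂ) (χ : ∀ i, G i → ℂ) : Prop :=
  ∀ i, CharacterCorresponds (ω.comp (RDP.zincl i)) (χ i)

/-- The ideal `J` has a bounded approximate identity: a net (given here by its tail filter) in a
bounded subset of `J` with `u * a → a` and `a * u → a` for every `a` in `J`. -/
def HasBoundedApproximateIdentity {A : Type*} [NormedRing A] (J : Ideal A) : Prop :=
  ∃ l : Filter A, l.NeBot ∧ (∃ C : ℝ, ∀ᶠ u in l, u ∈ J ∧ ‖u‖ ≤ C) ∧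
    ∀ a ∈ J, Tendsto (fun u => u * a) l (𝓝 a) ∧ Tendsto (fun u => a * u) l (𝓝 a)

end

/-!
A character `χ` of an irreducible representation of a finite group `Γ` enters only through its
normalization `f = χ / χ(1)`, which satisfies `f(1) = 1` and the product formula
`|Γ| f(x) f(y) = ∑_g f(x g y g⁻¹)` (`IsNormalizedCharacter`). Evaluating a character of `Zℓ¹(Γ)` on
class sums gives such an `f`, and an irreducible part of the right regular representation generated
by it realizes `f` as a normalized character; the degree is then recovered from the orthogonality
relation. This gives the family `(χ_i)` and its uniqueness.

Let `e_i` be the minimal central idempotent of `G_i` given by `χ_i`; the condition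
`χ_i(1) ‖χ_i‖₁ = |G_i|` says that `‖e_i‖ = 1`, and `ω(e_i) = 1` gives `‖e_i‖ ≥ 1` always. Multiplying by
`e_i` has the effect of integrating the `i`-th coordinate against `f_i`
(`factorIdempotent_mul`), so for a finite set `T` of indices and `e_T = ∏_{i ∈ T} e_i` every product
`e_T F` equals `e_T W` with `W` supported on the other factors, and `‖e_T W‖ = ∏_{i ∈ T} ‖e_i‖ ‖W‖`.

* If `‖e_i‖ = 1` for almost all `i`, the elements `1 - e_T` form a bounded net in `ker ω`. If `F` is
  supported on the factors in `T`, then `e_T F = ω(F) e_T`; as finitely supported truncations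
  approximate every `F ∈ ker ω`, it follows that `e_T F → 0`.
* If `ker ω` has an approximate identity bounded by `C`, choose `u` in it with `u (1 - e_T)` near
  `1 - e_T`. Then `v = 1 - u` satisfies `ω(v) = 1` and `‖e_T v‖ ≤ C + 2`, while
  `‖e_T v‖ ≥ ∏_{i ∈ T} ‖e_i‖`. So these products are bounded.

Boundedness of the products forces `‖e_i‖ = 1` for almost all `i` because of a gap
(`IsNormalizedCharacter.sum_norm_eq_of_le`): `‖e‖ ≤ 1 + 1/1000` implies `‖e‖ = 1`. To see this, note that
under the hypothesis most of the mass of `|f|²` sits where `|f|` is almost `1`. As `f` is positive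
definite, `|f(xy) - f(x) f(y)|² ≤ (1 - |f(x)|²) (1 - |f(y)|²)`, and a counting argument shows that
`M = {|f| ≥ 96/100}` is a subgroup. Its elements act almost by scalars on the ideal generated by `e`,
so conjugation by them is uniformly close to the identity there; averaging over `M` shows that it is
the identity. Hence `|f| = 1` on `M`, so `f` is a linear character of `M`, and its idempotent differs
from `e` by an idempotent of norm less than `1`, which is zero.
-/

noncomputable section

/-! ### Normalized characters of a finite group and irreducible representations -/

/-- A normalized character of a finite group `Γ`: a function `f` with `f 1 = 1` satisfying the
product formula `|Γ| f(x) f(y) = ∑_g f(x g y g⁻¹)`. These are exactly the functions `χ / χ(1)` for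
irreducible characters `χ`; the product formula is the form in which irreducibility
is used throughout. -/
structure IsNormalizedCharacter {Γ : Type*} [Group Γ] [Fintype Γ] (f : Γ → ℂ) : Prop where
  one : f 1 = 1
  sum_conj : ∀ x y, ∑ g, f (x * (g * y * g⁻¹)) = (Fintype.card Γ : ℂ) * (f x * f y)

theorem Fintype.card_group_complex_ne_zero (Γ : Type*) [Group Γ] [Fintype Γ] :
    (Fintype.card Γ : ℂ) ≠ 0 :=
  Nat.cast_ne_zero.2 Fintype.card_ne_zero

theorem Fintype.card_group_real_pos (Γ : Type*) [Group Γ] [Fintype Γ] :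
    (0 : ℝ) < Fintype.card Γ :=
  Nat.cast_pos.2 Fintype.card_pos

section FiniteGroup

variable {Γ : Type*} [Group Γ] [Fintype Γ]

namespace IsNormalizedCharacter

variable {f : Γ → ℂ} (hf : IsNormalizedCharacter f)
include hf

theorem conj (h y : Γ) : f (h * y * h⁻¹) = f y := by
  have h1 := hf.sum_conj 1 y
  have h2 := hf.sum_conj 1 (h * y * h⁻¹)
  rw [← Equiv.sum_comp (Equiv.mulRight h)] at h1
  simp only [Equiv.coe_mulRight, one_mul, hf.one] at h1 h2
  have h3 : ∀ g, g * h * y * (g * h)⁻¹ = g * (h * y * h⁻¹) * g⁻¹ := fun g => by group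
  simp only [h3] at h1
  exact mul_left_cancel₀ (Fintype.card_group_complex_ne_zero Γ) (h2.symm.trans h1)

theorem mul_comm_arg (x y : Γ) : f (x * y) = f (y * x) := by
  rw [← hf.conj y (x * y)]
  congr 1
  group

/-- Convolving a normalized character with a class function multiplies it by a scalar. -/
theorem sum_mul_class {h : Γ → ℂ} (hh : ∀ x g, h (g * x * g⁻¹) = h x) (x : Γ) :
    ∑ a, f (x * a⁻¹) * h a = f x * ∑ a, f a⁻¹ * h a := by
  refine mul_left_cancel₀ (Fintype.card_group_complex_ne_zero Γ) ?_
  calc (Fintype.card Γ : ℂ) * ∑ a, f (x * a⁻¹) * h a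
      = ∑ _g : Γ, ∑ a, f (x * a⁻¹) * h a := by simp
    _ = ∑ g : Γ, ∑ a, f (x * (g * a⁻¹ * g⁻¹)) * h a := by
        refine Finset.sum_congr rfl fun g _ => ?_
        rw [← (MulAut.conj g).toEquiv.sum_comp]
        refine Finset.sum_congr rfl fun a _ => ?_
        simp only [MulEquiv.toEquiv_eq_coe, MulEquiv.coe_toEquiv, MulAut.conj_apply, hh]
        congr 3
        group
    _ = ∑ a, (∑ g, f (x * (g * a⁻¹ * g⁻¹))) * h a := by
        rw [Finset.sum_comm]
        simp only [Finset.sum_mul]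
    _ = _ := by
        simp only [hf.sum_conj, Finset.mul_sum]
        exact Finset.sum_congr rfl fun a _ => by ring

theorem sum_normSq_pos : 0 < ∑ a, ‖f a‖ ^ 2 :=
  Finset.sum_pos' (fun _ _ => by positivity) ⟨1, Finset.mem_univ _, by simp [hf.one]⟩

/-- Both `f` and `x ↦ conj (f x⁻¹)` satisfy `sum_mul_class`, and comparing the two
expressions for their convolution shows that they agree. -/
theorem apply_inv (x : Γ) : f x⁻¹ = star (f x) := by
  have hc : ∀ x g, star (f (g * x * g⁻¹)⁻¹) = star (f x⁻¹) := fun x g => by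
    rw [← hf.conj g x⁻¹]; congr 2; group
  have h1 := hf.sum_mul_class (h := fun a => star (f a⁻¹)) hc x⁻¹
  have h2 := hf.sum_mul_class (h := fun a => star (f a⁻¹)) hc x
  have hN : ∑ a, f a⁻¹ * star (f a⁻¹) = ((∑ a, ‖f a‖ ^ 2 : ℝ) : ℂ) := by
    rw [← Equiv.sum_comp (Equiv.inv Γ)]
    simp [Complex.mul_conj, Complex.normSq_eq_norm_sq]
  have h3 : ∑ a, star (f (x⁻¹ * a⁻¹) * star (f a⁻¹)) = ∑ a, f (x * a⁻¹) * star (f a⁻¹) := by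
    rw [← Equiv.sum_comp (Equiv.mulRight x) fun a => f (x * a⁻¹) * star (f a⁻¹)]
    refine Finset.sum_congr rfl fun a _ => ?_
    simp only [star_mul', star_star, Equiv.coe_mulRight, mul_inv_rev, mul_inv_cancel_left]
    ring
  rw [← star_sum, h1, h2, hN, star_mul'] at h3
  have h4 : star ((∑ a, ‖f a‖ ^ 2 : ℝ) : ℂ) = ((∑ a, ‖f a‖ ^ 2 : ℝ) : ℂ) := Complex.conj_ofReal _
  rw [h4] at h3
  have h5 := mul_right_cancel₀ (Complex.ofReal_ne_zero.2 hf.sum_normSq_pos.ne') h3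
  rw [← h5, star_star]

end IsNormalizedCharacter

open Representation in
/-- By Schur's lemma the sum of `ρ` over a conjugacy class is a scalar. -/
theorem Representation.sum_conj_character {n : ℕ} (ρ : Representation ℂ Γ (Fin n → ℂ))
    [ρ.IsIrreducible] (x y : Γ) :
    ρ.character 1 * ∑ g, ρ.character (x * (g * y * g⁻¹)) =
      (Fintype.card Γ : ℂ) * (ρ.character x * ρ.character y) := by
  have hcomm : ∀ h : Γ, (∑ g, ρ (g * y * g⁻¹)) ∘ₗ ρ h = ρ h ∘ₗ (∑ g, ρ (g * y * g⁻¹)) := by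
    intro h
    rw [← Module.End.mul_eq_comp, ← Module.End.mul_eq_comp, Finset.sum_mul, Finset.mul_sum,
      ← Equiv.sum_comp (Equiv.mulLeft h)]
    refine Finset.sum_congr rfl fun g _ => ?_
    rw [← map_mul, ← map_mul]
    congr 1
    simp only [Equiv.coe_mulLeft]
    group
  obtain ⟨c, hc⟩ := (IsIrreducible.algebraMap_intertwiningMap_bijective_of_isAlgClosed
    (ρ := ρ)).2 ⟨_, hcomm⟩
  have hT : ∑ g, ρ (g * y * g⁻¹) = c • (1 : Module.End ℂ (Fin n → ℂ)) := by
    have := congrArg IntertwiningMap.toLinearMap hc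
    exact this.symm
  have h1 : (Fintype.card Γ : ℂ) * ρ.character y = c * ρ.character 1 := by
    have := congrArg (LinearMap.trace ℂ (Fin n → ℂ)) hT
    rw [map_sum, map_smul, ← map_one ρ, smul_eq_mul] at this
    change ∑ g, ρ.character (g * y * g⁻¹) = c * ρ.character 1 at this
    simpa [char_conj] using this
  have h2 : ∑ g, ρ.character (x * (g * y * g⁻¹)) = c * ρ.character x := by
    have := congrArg (fun T => LinearMap.trace ℂ (Fin n → ℂ) (ρ x * T)) hT
    simp only [Finset.mul_sum, map_sum, mul_smul_comm, map_smul, mul_one, smul_eq_mul,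
      ← map_mul] at this
    exact this
  rw [h2, mul_left_comm, mul_left_comm (Fintype.card Γ : ℂ), h1]
  ring

theorem IsIrreducibleCharacter.exists_degree {Γ : Type*} [Group Γ] {χ : Γ → ℂ} (h : IsIrreducibleCharacter χ) :
    ∃ n : ℕ, 0 < n ∧ χ 1 = n := by
  obtain ⟨n, ρ, hρ, rfl⟩ := h
  refine ⟨n, Nat.pos_of_ne_zero ?_, by simp⟩
  rintro rfl
  obtain ⟨a, b, hab⟩ := hρ.toNontrivial
  refine hab (Subrepresentation.toSubmodule_injective (Subsingleton.elim _ _))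

theorem IsIrreducibleCharacter.sum_mul_inv {χ : Γ → ℂ} (h : IsIrreducibleCharacter χ) :
    ∑ x, χ x * χ x⁻¹ = Fintype.card Γ := by
  obtain ⟨n, ρ, hρ, rfl⟩ := h
  have hn : (Nat.card Γ : ℂ) ≠ 0 := by
    rw [Nat.card_eq_fintype_card]; exact Fintype.card_group_complex_ne_zero Γ
  let _ : Invertible (Nat.card Γ : ℂ) := invertibleOfNonzero hn
  have := Representation.char_orthonormal ρ ρ
  rw [if_pos ⟨Representation.Equiv.refl ρ⟩, inv_mul_eq_iff_eq_mul₀ hn, mul_one] at this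
  rw [this, Nat.card_eq_fintype_card]

theorem IsIrreducibleCharacter.isNormalizedCharacter {χ : Γ → ℂ}
    (h : IsIrreducibleCharacter χ) : IsNormalizedCharacter fun x => (χ 1)⁻¹ * χ x := by
  obtain ⟨d, hd, h1⟩ := h.exists_degree
  have hd' : χ 1 ≠ 0 := by rw [h1]; exact Nat.cast_ne_zero.2 hd.ne'
  obtain ⟨n, ρ, hρ, rfl⟩ := h
  refine ⟨inv_mul_cancel₀ hd', fun x y => ?_⟩
  rw [← Finset.mul_sum]
  have := ρ.sum_conj_character x y
  field_simp
  linear_combination this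

/-- The functions `v` on `Γ` with `∑_g v(x g y g⁻¹) = |Γ| v(x) f(y)`: the part of the regular
representation on which the class sums act through `f`. -/
def IsNormalizedCharacter.eigenspace (f : Γ → ℂ) : Submodule ℂ (Γ → ℂ) where
  carrier := {v | ∀ x y, ∑ g, v (x * (g * y * g⁻¹)) = (Fintype.card Γ : ℂ) * (v x * f y)}
  zero_mem' := by simp
  add_mem' {v w} hv hw x y := by
    simp only [Pi.add_apply, Finset.sum_add_distrib, hv x y, hw x y]; ring
  smul_mem' c v hv x y := by
    simp only [Pi.smul_apply, smul_eq_mul, ← Finset.mul_sum, hv x y]; ring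

/-- The right regular representation on functions, `(ρ(h) v)(x) = v(x h)`. -/
def rightRegular (Γ : Type*) [Group Γ] : Representation ℂ Γ (Γ → ℂ) where
  toFun h := LinearMap.funLeft ℂ ℂ (· * h)
  map_one' := by ext; simp [LinearMap.funLeft]
  map_mul' g h := by ext; simp [LinearMap.funLeft, mul_assoc]

theorem rightRegular_apply {Γ : Type*} [Group Γ] (h : Γ) (v : Γ → ℂ) (x : Γ) :
    rightRegular Γ h v x = v (x * h) := rfl

theorem IsNormalizedCharacter.rightRegular_mem_eigenspace {f v : Γ → ℂ}
    (hv : v ∈ eigenspace f) (h : Γ) : rightRegular Γ h v ∈ eigenspace f := by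
  intro x y
  rw [rightRegular_apply, ← hv (x * h) y, ← Equiv.sum_comp (Equiv.mulLeft h)]
  refine Finset.sum_congr rfl fun g _ => ?_
  rw [rightRegular_apply]
  congr 1
  simp only [Equiv.coe_mulLeft]
  group

/-- An irreducible subrepresentation of the eigenspace of `f` has character `d • f`. -/
theorem IsNormalizedCharacter.exists_isIrreducibleCharacter {f : Γ → ℂ}
    (hf : IsNormalizedCharacter f) :
    ∃ χ : Γ → ℂ, IsIrreducibleCharacter χ ∧ ∀ x, χ x = χ 1 * f x := by
  classical
  -- A nonzero invariant subspace of the eigenspace of minimal dimension.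
  let P : Submodule ℂ (Γ → ℂ) → Prop := fun U =>
    U ≠ ⊥ ∧ U ≤ eigenspace f ∧ ∀ h, ∀ v ∈ U, rightRegular Γ h v ∈ U
  have hP : P (eigenspace f) := by
    refine ⟨fun h0 => ?_, le_rfl, fun h v hv => rightRegular_mem_eigenspace hv h⟩
    have hmem : f ∈ eigenspace f := hf.sum_conj
    rw [h0, Submodule.mem_bot] at hmem
    have := hf.one
    simp [hmem] at this
  obtain ⟨U, ⟨hU0, hUe, hUi⟩, hmin⟩ : ∃ U, P U ∧ ∀ U', P U' →
      Module.finrank ℂ U ≤ Module.finrank ℂ U' := by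
    obtain ⟨U, hU, h⟩ := WellFounded.has_min
      (InvImage.wf (fun U : Submodule ℂ (Γ → ℂ) => Module.finrank ℂ U) wellFounded_lt)
      {U | P U} ⟨_, hP⟩
    exact ⟨U, hU, fun U' hU' => not_lt.1 (h U' hU')⟩
  let n := Module.finrank ℂ U
  let e : U ≃ₗ[ℂ] (Fin n → ℂ) := (Module.finBasis ℂ U).equivFun
  let σ : Representation ℂ Γ U := (⟨U, fun h v hv => hUi h v hv⟩ :
    Subrepresentation (rightRegular Γ)).toRepresentation
  let ρ : Representation ℂ Γ (Fin n → ℂ) :=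
    { toFun := fun h => e.conj (σ h)
      map_one' := by ext; simp [LinearEquiv.conj_apply]
      map_mul' := fun g h => by ext; simp [LinearEquiv.conj_apply] }
  have hirr : ρ.IsIrreducible := by
    have hn : 0 < n := Submodule.one_le_finrank_iff.2 hU0
    refine { exists_pair_ne := ⟨⊥, ⊤, fun h => ?_⟩, eq_bot_or_eq_top := fun Q => ?_ }
    · have h1 : (⊥ : Submodule ℂ (Fin n → ℂ)) = ⊤ := congrArg Subrepresentation.toSubmodule h
      have : Nonempty (Fin n) := ⟨⟨0, hn⟩⟩
      exact bot_ne_top h1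
    · by_cases hQ : Q = ⊥
      · exact Or.inl hQ
      right
      let j : (Fin n → ℂ) →ₗ[ℂ] (Γ → ℂ) := U.subtype ∘ₗ e.symm.toLinearMap
      have hj : Function.Injective j := U.injective_subtype.comp e.symm.injective
      have hQ0 : Q.toSubmodule ≠ ⊥ := fun h => hQ (Subrepresentation.toSubmodule_injective h)
      have hle := hmin (Q.toSubmodule.map j) ⟨?_, ?_, ?_⟩
      · rw [← (Submodule.equivMapOfInjective j hj Q.toSubmodule).finrank_eq] at hle
        apply Subrepresentation.toSubmodule_injective
        exact Submodule.eq_top_of_finrank_eq (le_antisymm (Submodule.finrank_le _) (by simpa using hle))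
      · rw [← Submodule.map_bot j]
        exact (Submodule.map_injective_of_injective hj).ne hQ0
      · rintro _ ⟨v, -, rfl⟩
        exact hUe (e.symm v).2
      · rintro h _ ⟨v, hv, rfl⟩
        refine ⟨ρ h v, Q.apply_mem_toSubmodule h hv, ?_⟩
        change ((e.symm (e (σ h (e.symm v))) : U) : Γ → ℂ) = _
        rw [e.symm_apply_apply]
        rfl
  refine ⟨ρ.character, ⟨n, ρ, hirr, rfl⟩, fun y => ?_⟩
  have hsum : ∑ g, ρ (g * y * g⁻¹) = ((Fintype.card Γ : ℂ) * f y) • ρ 1 := by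
    change ∑ g, e.conj (σ (g * y * g⁻¹)) = ((Fintype.card Γ : ℂ) * f y) • e.conj (σ 1)
    rw [← map_sum, ← map_smul]
    congr 1
    ext v x
    simp only [LinearMap.sum_apply, map_one, LinearMap.smul_apply, Module.End.one_apply,
      Submodule.coe_sum, Submodule.coe_smul, Finset.sum_apply, Pi.smul_apply, smul_eq_mul]
    have := hUe v.2 x y
    rw [mul_comm (v.1 x), ← mul_assoc] at this
    exact this
  have htr := congrArg (LinearMap.trace ℂ (Fin n → ℂ)) hsum
  rw [map_sum, map_smul, smul_eq_mul] at htr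
  change ∑ g, ρ.character (g * y * g⁻¹) = _ * ρ.character 1 at htr
  simp only [Representation.char_conj, Finset.sum_const, Finset.card_univ, nsmul_eq_mul] at htr
  refine mul_left_cancel₀ (Fintype.card_group_complex_ne_zero Γ) ?_
  rw [htr]
  ring

end FiniteGroup

/-! ### The group algebra of a finite group and the characters of its centre -/

namespace EllOne

theorem delta_mul_delta {G : Type*} [Group G] (g h : G) : delta g * delta h = delta (g * h) := by
  ext x
  rw [delta_mul_apply, delta_apply, delta_apply]
  by_cases hx : x = g * h
  · rw [if_pos hx, if_pos (inv_mul_eq_iff_eq_mul.2 hx)]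
  · rw [if_neg hx, if_neg (mt inv_mul_eq_iff_eq_mul.1 hx)]

theorem algHom_smul {G : Type*} [Group G] (ψ : ZEllOne G →ₐ[ℂ] ℂ) (c : ℂ) (f : ZEllOne G) :
    ψ (c • f) = c * ψ f :=
  ψ.toLinearMap.map_smul c f

theorem sum_apply {G ι : Type*} (s : Finset ι) (F : ι → EllOne G) (x : G) :
    (∑ i ∈ s, F i) x = ∑ i ∈ s, F i x := by
  rw [lp.coeFn_sum, Finset.sum_apply]

theorem norm_delta {G : Type*} (g : G) : ‖delta g‖ = 1 := by
  simp [delta, lp.norm_single]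

/-- A function on a finite group, as an element of `ℓ¹`. -/
def ofFun {Γ : Type*} [Fintype Γ] (f : Γ → ℂ) : EllOne Γ :=
  ⟨f, (memlp_iff f).2 (Summable.of_finite)⟩

@[simp]
theorem ofFun_apply {Γ : Type*} [Fintype Γ] (f : Γ → ℂ) (x : Γ) : ofFun f x = f x := rfl

theorem norm_eq_sum {Γ : Type*} [Fintype Γ] (f : EllOne Γ) : ‖f‖ = ∑ x, ‖f x‖ := by
  rw [norm_eq, tsum_fintype]

section Finite

variable {Γ : Type*} [Group Γ] [Fintype Γ]

theorem mul_apply_fintype (f g : EllOne Γ) (x : Γ) : (f * g) x = ∑ y, f y * g (y⁻¹ * x) := by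
  rw [mul_apply, tsum_fintype]

/-- The sum `∑_g δ_{g x g⁻¹}`, a central element of the group algebra. -/
def classSum (x : Γ) : ZEllOne Γ :=
  ⟨∑ g, delta (g * x * g⁻¹), by
    rw [mem_center_iff]
    intro y k
    rw [sum_apply, sum_apply, ← Equiv.sum_comp (Equiv.mulLeft k)]
    refine Finset.sum_congr rfl fun g _ => ?_
    rw [delta_apply, delta_apply]
    congr 1
    simp only [Equiv.coe_mulLeft, mul_inv_rev, eq_iff_iff]
    constructor
    · intro h
      have := congrArg (fun z => k⁻¹ * z * k) h
      simpa [mul_assoc] using this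
    · rintro rfl
      group⟩

theorem classSum_val (x : Γ) : (classSum x : EllOne Γ) = ∑ g, delta (g * x * g⁻¹) := rfl

theorem classSum_one : classSum (1 : Γ) = (Fintype.card Γ : ℂ) • 1 := by
  apply Subtype.ext
  rw [classSum_val]
  simp [one_def, ← Nat.cast_smul_eq_nsmul ℂ]

theorem classSum_conj (x h : Γ) : classSum (h * x * h⁻¹) = classSum x := by
  apply Subtype.ext
  rw [classSum_val, classSum_val, ← Equiv.sum_comp (Equiv.mulRight h) fun g => delta (g * x * g⁻¹)]
  refine Finset.sum_congr rfl fun g _ => ?_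
  congr 1
  simp only [Equiv.coe_mulRight]
  group

theorem classSum_mul (x y : Γ) :
    classSum x * classSum y = ∑ k, classSum (x * (k * y * k⁻¹)) := by
  apply Subtype.ext
  rw [Subalgebra.coe_mul, AddSubmonoidClass.coe_finsetSum]
  simp only [classSum_val]
  rw [Finset.sum_mul, Finset.sum_comm]
  refine Finset.sum_congr rfl fun g _ => ?_
  rw [Finset.mul_sum, ← Equiv.sum_comp (Equiv.mulLeft g)]
  refine Finset.sum_congr rfl fun k _ => ?_
  rw [delta_mul_delta]
  congr 1
  simp only [Equiv.coe_mulLeft]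
  group

theorem card_smul_eq_sum_classSum (f : ZEllOne Γ) :
    (Fintype.card Γ : ℂ) • f = ∑ x, (f : EllOne Γ) x • classSum x := by
  apply Subtype.ext
  ext y
  have hf := (mem_center_iff _).1 f.2
  rw [AddSubmonoidClass.coe_finsetSum, sum_apply]
  simp only [SetLike.val_smul, lp.coeFn_smul, Pi.smul_apply, smul_eq_mul, classSum_val, sum_apply,
    Finset.mul_sum]
  rw [Finset.sum_comm]
  have : ∀ g : Γ, ∑ x, (f : EllOne Γ) x * delta (g * x * g⁻¹) y = (f : EllOne Γ) y := by
    intro g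
    rw [Finset.sum_eq_single (g⁻¹ * y * g)]
    · rw [delta_apply, if_pos (by group), mul_one]
      simpa using hf y g⁻¹
    · intro x _ hx
      rw [delta_apply, if_neg, mul_zero]
      rintro rfl
      exact hx (by group)
    · simp
  simp [this]

/-- For an algebra character `ψ` of the centre, the values of `ψ` at the averages over the
conjugacy classes of inverses. -/
def ofAlgHom (ψ : ZEllOne Γ →ₐ[ℂ] ℂ) (x : Γ) : ℂ := (Fintype.card Γ : ℂ)⁻¹ * ψ (classSum x⁻¹)

theorem isNormalizedCharacter_ofAlgHom (ψ : ZEllOne Γ →ₐ[ℂ] ℂ) :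
    IsNormalizedCharacter (ofAlgHom ψ) := by
  have hn := Fintype.card_group_complex_ne_zero Γ
  refine ⟨?_, fun x y => ?_⟩
  · rw [ofAlgHom, inv_one, classSum_one, algHom_smul, map_one, mul_one,
      inv_mul_cancel₀ hn]
  · simp only [ofAlgHom]
    rw [← Finset.mul_sum]
    have h : ∑ g, ψ (classSum (x * (g * y * g⁻¹))⁻¹) = ψ (classSum x⁻¹) * ψ (classSum y⁻¹) := by
      rw [← map_mul, classSum_mul, map_sum]
      refine Finset.sum_congr rfl fun g _ => ?_
      rw [← classSum_conj _ x⁻¹]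
      congr 2
      group
    rw [h]
    field_simp

theorem algHom_apply_eq_sum (ψ : ZEllOne Γ →ₐ[ℂ] ℂ) (f : ZEllOne Γ) :
    ψ f = ∑ x, (f : EllOne Γ) x * ofAlgHom ψ x⁻¹ := by
  have hn := Fintype.card_group_complex_ne_zero Γ
  refine mul_left_cancel₀ hn ?_
  rw [← algHom_smul, card_smul_eq_sum_classSum, map_sum, Finset.mul_sum]
  refine Finset.sum_congr rfl fun x _ => ?_
  rw [algHom_smul, ofAlgHom, inv_inv]
  field_simp

end Finite
end EllOne

section Correspondence

open EllOne

variable {Γ : Type*} [Group Γ] [Fintype Γ] {ψ : ZEllOne Γ →ₐ[ℂ] ℂ} {χ : Γ → ℂ}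

theorem CharacterCorresponds.eq_ofAlgHom (h : CharacterCorresponds ψ χ) (x : Γ) :
    (χ 1)⁻¹ * χ x = ofAlgHom ψ x := by
  have hn := Fintype.card_group_complex_ne_zero Γ
  have hc := h.1.isNormalizedCharacter.conj
  rw [ofAlgHom, h.2, eq_inv_mul_iff_mul_eq₀ hn]
  simp only [classSum_val, EllOne.sum_apply, Finset.sum_mul]
  rw [Finset.sum_comm]
  have : ∀ g : Γ, ∑ y, delta (g * x⁻¹ * g⁻¹) y * ((χ 1)⁻¹ * χ y⁻¹) = (χ 1)⁻¹ * χ x := by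
    intro g
    rw [Finset.sum_eq_single (g * x⁻¹ * g⁻¹)]
    · rw [delta_apply, if_pos rfl, one_mul, ← hc g x]
      congr 2
      group
    · intro y _ hy
      rw [delta_apply, if_neg hy, zero_mul]
    · simp
  simp [this]

theorem exists_characterCorresponds (ψ : ZEllOne Γ →ₐ[ℂ] ℂ) : ∃ χ, CharacterCorresponds ψ χ := by
  obtain ⟨χ, hχ, h⟩ := (isNormalizedCharacter_ofAlgHom ψ).exists_isIrreducibleCharacter
  refine ⟨χ, hχ, fun f => ?_⟩
  obtain ⟨d, hd, h1⟩ := hχ.exists_degree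
  have hd' : χ 1 ≠ 0 := by rw [h1]; exact Nat.cast_ne_zero.2 hd.ne'
  rw [algHom_apply_eq_sum]
  refine Finset.sum_congr rfl fun x _ => ?_
  rw [h x⁻¹, inv_mul_cancel_left₀ hd']

/-- The normalized character determines the degree through `∑ χ(x) χ(x⁻¹) = |Γ|`. -/
theorem CharacterCorresponds.unique {χ' : Γ → ℂ} (h : CharacterCorresponds ψ χ)
    (h' : CharacterCorresponds ψ χ') : χ = χ' := by
  obtain ⟨d, hd, h1⟩ := h.1.exists_degree
  obtain ⟨d', hd', h1'⟩ := h'.1.exists_degree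
  have hd0 : (d : ℂ) ≠ 0 := Nat.cast_ne_zero.2 hd.ne'
  have hd0' : (d' : ℂ) ≠ 0 := Nat.cast_ne_zero.2 hd'.ne'
  have e : ∀ x, χ x = d * ofAlgHom ψ x := fun x => by
    rw [← h.eq_ofAlgHom, h1, mul_inv_cancel_left₀ hd0]
  have e' : ∀ x, χ' x = d' * ofAlgHom ψ x := fun x => by
    rw [← h'.eq_ofAlgHom, h1', mul_inv_cancel_left₀ hd0']
  have hs : ∀ {c : ℕ} {η : Γ → ℂ}, IsIrreducibleCharacter η → (∀ x, η x = c * ofAlgHom ψ x) →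
      (c : ℂ) ^ 2 * ∑ x, ofAlgHom ψ x * ofAlgHom ψ x⁻¹ = Fintype.card Γ := by
    intro c η hη he
    rw [← hη.sum_mul_inv, Finset.mul_sum]
    refine Finset.sum_congr rfl fun x _ => ?_
    rw [he, he]
    ring
  have hdd : (d : ℂ) ^ 2 = (d' : ℂ) ^ 2 := by
    have h2 := (hs h.1 e).trans (hs h'.1 e').symm
    refine mul_right_cancel₀ (fun h0 => ?_) h2
    have := hs h.1 e
    rw [h0, mul_zero] at this
    exact Fintype.card_group_complex_ne_zero Γ this.symm
  have : d = d' := by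
    have h3 : d ^ 2 = d' ^ 2 := by exact_mod_cast hdd
    exact Nat.pow_left_injective two_ne_zero h3
  funext x
  rw [e, e', this]

end Correspondence

/-! ### Positive definiteness of normalized characters -/

open scoped InnerProductSpace in
/-- Gram inequality for three unit vectors. -/
theorem norm_inner_sub_mul_sq_le {E : Type*} [NormedAddCommGroup E] [InnerProductSpace ℂ E]
    {a o b : E} (ha : ‖a‖ = 1) (ho : ‖o‖ = 1) (hb : ‖b‖ = 1) :
    ‖⟪a, b⟫_ℂ - ⟪a, o⟫_ℂ * ⟪o, b⟫_ℂ‖ ^ 2 ≤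
      (1 - ‖⟪a, o⟫_ℂ‖ ^ 2) * (1 - ‖⟪o, b⟫_ℂ‖ ^ 2) := by
  have hoo : ⟪o, o⟫_ℂ = 1 := by rw [inner_self_eq_norm_sq_to_K, ho]; simp
  have key : ∀ c : E, ‖c‖ = 1 → ‖c - ⟪o, c⟫_ℂ • o‖ ^ 2 = 1 - ‖⟪o, c⟫_ℂ‖ ^ 2 := by
    intro c hc
    rw [norm_sub_sq (𝕜 := ℂ), inner_smul_right, ← inner_conj_symm c o, Complex.mul_conj',
      norm_smul, ho, hc, mul_one, RCLike.re_eq_complex_re, ← Complex.ofReal_pow,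
      Complex.ofReal_re]
    ring
  have h := norm_inner_le_norm (𝕜 := ℂ) (a - ⟪o, a⟫_ℂ • o) (b - ⟪o, b⟫_ℂ • o)
  have h2 : ⟪a - ⟪o, a⟫_ℂ • o, b - ⟪o, b⟫_ℂ • o⟫_ℂ = ⟪a, b⟫_ℂ - ⟪a, o⟫_ℂ * ⟪o, b⟫_ℂ := by
    simp only [inner_sub_left, inner_sub_right, inner_smul_left, inner_smul_right, hoo,
      inner_conj_symm]
    ring
  rw [h2] at h
  rw [← norm_inner_symm o a, ← key a ha, ← key b hb, ← mul_pow]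
  gcongr

section FiniteGroup

variable {Γ : Type*} [Group Γ] [Fintype Γ] {f : Γ → ℂ}

namespace IsNormalizedCharacter

variable (hf : IsNormalizedCharacter f)
include hf

open scoped InnerProductSpace in
/-- A normalized character is positive definite: its left translates are, up to a factor, unit
vectors of `ℓ²(Γ)` with Gram matrix `f (x⁻¹ y)`. -/
theorem exists_gram : ∃ v : Γ → EuclideanSpace ℂ Γ,
    (∀ x y, ⟪v x, v y⟫_ℂ = f (x⁻¹ * y)) ∧ ∀ x, ‖v x‖ = 1 := by
  set N := ∑ a, ‖f a‖ ^ 2 with hN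
  have hN0 : 0 < N := hf.sum_normSq_pos
  let v : Γ → EuclideanSpace ℂ Γ := fun x => WithLp.toLp 2 fun a => ((√N)⁻¹ : ℝ) * f (a⁻¹ * x)
  have hv : ∀ x y, ⟪v x, v y⟫_ℂ = f (x⁻¹ * y) := by
    intro x y
    rw [PiLp.inner_apply]
    simp only [v, RCLike.inner_apply, map_mul, Complex.conj_ofReal]
    have h1 := hf.sum_mul_class (h := f) (fun x g => hf.conj g x) (x⁻¹ * y)
    have h2 : ∑ a, f a⁻¹ * f a = (N : ℂ) := by
      rw [hN, Complex.ofReal_sum]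
      refine Finset.sum_congr rfl fun a _ => ?_
      rw [hf.apply_inv, Complex.ofReal_pow]
      exact Complex.conj_mul' _
    have h3 : ((√N)⁻¹ : ℝ) * ((√N)⁻¹ : ℝ) = N⁻¹ := by
      rw [← mul_inv, Real.mul_self_sqrt hN0.le]
    have h4 : ∀ a, (((√N)⁻¹ : ℝ) : ℂ) * f (a⁻¹ * y) *
        ((((√N)⁻¹ : ℝ) : ℂ) * (starRingEnd ℂ) (f (a⁻¹ * x))) =
        (N : ℂ)⁻¹ * (f (a⁻¹ * y) * f (x⁻¹ * a)) := by
      intro a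
      have h5 : (starRingEnd ℂ) (f (a⁻¹ * x)) = f (x⁻¹ * a) := by
        have := hf.apply_inv (a⁻¹ * x)
        rw [mul_inv_rev, inv_inv] at this
        exact this.symm
      rw [h5, ← Complex.ofReal_inv N, ← h3, Complex.ofReal_mul]
      ring
    simp only [h4]
    rw [← Finset.mul_sum, ← Equiv.sum_comp (Equiv.mulLeft x)]
    simp only [Equiv.coe_mulLeft, inv_mul_cancel_left]
    have h6 : ∀ a, f ((x * a)⁻¹ * y) = f (x⁻¹ * y * a⁻¹) := fun a => by
      rw [hf.mul_comm_arg, mul_inv_rev, ← mul_assoc, hf.mul_comm_arg, ← mul_assoc]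
    simp only [h6, h1, h2]
    rw [mul_left_comm, inv_mul_cancel₀ (Complex.ofReal_ne_zero.2 hN0.ne'), mul_one]
  refine ⟨v, hv, fun x => ?_⟩
  have := inner_self_eq_norm_sq (𝕜 := ℂ) (v x)
  rw [hv, inv_mul_cancel, hf.one, RCLike.one_re] at this
  nlinarith [norm_nonneg (v x)]

theorem norm_mul_sub_sq_le (x y : Γ) :
    ‖f (x * y) - f x * f y‖ ^ 2 ≤ (1 - ‖f x‖ ^ 2) * (1 - ‖f y‖ ^ 2) := by
  obtain ⟨v, hv, hn⟩ := hf.exists_gram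
  simpa [hv] using norm_inner_sub_mul_sq_le (hn x⁻¹) (hn 1) (hn y)

theorem norm_le_one (x : Γ) : ‖f x‖ ≤ 1 := by
  obtain ⟨v, hv, hn⟩ := hf.exists_gram
  simpa [hv, hn] using norm_inner_le_norm (𝕜 := ℂ) (v 1) (v x)

/-- Absolute values close to `1` are nearly preserved under products. -/
theorem le_norm_mul {x y : Γ} {p q r : ℝ} (hp : 0 ≤ p) (hq : 0 ≤ q) (hr : 0 ≤ r) (hx : p ≤ ‖f x‖)
    (hy : q ≤ ‖f y‖) (hpqr : (1 - p ^ 2) * (1 - q ^ 2) ≤ r ^ 2) : p * q - r ≤ ‖f (x * y)‖ := by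
  have h := hf.norm_mul_sub_sq_le x y
  have hx1 := hf.norm_le_one x
  have hy1 := hf.norm_le_one y
  have h1 : (1 - ‖f x‖ ^ 2) * (1 - ‖f y‖ ^ 2) ≤ (1 - p ^ 2) * (1 - q ^ 2) := by
    gcongr
    · nlinarith
    · nlinarith
  have h2 : ‖f (x * y) - f x * f y‖ ≤ r := by
    exact abs_le_of_sq_le_sq' (by linarith) hr |>.2
  have h3 : ‖f x * f y‖ - ‖f (x * y)‖ ≤ ‖f (x * y) - f x * f y‖ := by
    rw [norm_sub_rev]; exact norm_sub_norm_le _ _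
  have h4 : p * q ≤ ‖f x * f y‖ := by rw [norm_mul]; gcongr
  linarith

end IsNormalizedCharacter
end FiniteGroup

/-! ### The elements on which a normalized character is almost unimodular -/

section FiniteGroup

variable {Γ : Type*} [Group Γ] [Fintype Γ] {f : Γ → ℂ}

namespace IsNormalizedCharacter

section Gap

variable (hf : IsNormalizedCharacter f)
  (h : ∑ x, ‖f x‖ ≤ (1 + 1 / 1000) * ∑ x, ‖f x‖ ^ 2)
include hf h

/-- The hypothesis bounds `∑ ‖f‖ (1 - ‖f‖)`, so little mass lies where `‖f‖` is away from `1`. -/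
theorem sum_norm_filter_lt_le :
    ∑ x with ‖f x‖ < 99 / 100, ‖f x‖ ≤ 1 / 10 * ∑ x, ‖f x‖ ^ 2 := by
  have h1 : ∑ x with ‖f x‖ < 99 / 100, ‖f x‖ ≤ ∑ x, 100 * (‖f x‖ - ‖f x‖ ^ 2) := by
    rw [Finset.sum_filter]
    refine Finset.sum_le_sum fun x _ => ?_
    have h0 := norm_nonneg (f x)
    have h1 := hf.norm_le_one x
    split_ifs <;> nlinarith
  rw [← Finset.mul_sum, Finset.sum_sub_distrib] at h1
  linarith

theorem le_card_filter_le :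
    9 / 10 * ∑ x, ‖f x‖ ^ 2 ≤ ((Finset.univ.filter fun x => 99 / 100 ≤ ‖f x‖).card : ℝ) := by
  have h1 := hf.sum_norm_filter_lt_le h
  have h2 : ∑ x, ‖f x‖ ^ 2 - ∑ x with ‖f x‖ < 99 / 100, ‖f x‖ ≤
      ∑ x with 99 / 100 ≤ ‖f x‖, (1 : ℝ) := by
    rw [Finset.sum_filter, Finset.sum_filter, ← Finset.sum_sub_distrib]
    refine Finset.sum_le_sum fun x _ => ?_
    have h0 := norm_nonneg (f x)
    have h1 := hf.norm_le_one x
    split_ifs <;> nlinarith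
  rw [Finset.sum_const, nsmul_eq_mul, mul_one] at h2
  linarith

/-- The condition `96/100 ≤ ‖f‖` is closed under products although a product loses some absolute
value: the translate by `x y` of the set `S = {99/100 ≤ ‖f‖}` lies in `{1/2 ≤ ‖f‖}`, most of which
is `S`, so it meets `S`, and then `x y` is in `S S⁻¹`. -/
theorem le_norm_mul_of_le {x y : Γ} (hx : 96 / 100 ≤ ‖f x‖) (hy : 96 / 100 ≤ ‖f y‖) :
    96 / 100 ≤ ‖f (x * y)‖ := by
  have hN := hf.sum_normSq_pos
  have hxy : 84 / 100 ≤ ‖f (x * y)‖ :=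
    le_trans (by norm_num) (hf.le_norm_mul (r := 784 / 10000) (by norm_num) (by norm_num)
      (by norm_num) hx hy (by norm_num))
  by_contra hlt
  have hdisj : ∀ s, 99 / 100 ≤ ‖f s‖ → ‖f (x * y * s)‖ < 99 / 100 := by
    intro s hs
    by_contra! hs'
    apply hlt
    have := hf.le_norm_mul (p := 99 / 100) (q := 99 / 100) (r := 199 / 10000) (by norm_num)
      (by norm_num) (by norm_num) hs' (y := s⁻¹) (by rwa [hf.apply_inv, norm_star]) (by norm_num)
    rw [mul_inv_cancel_right] at this
    exact le_trans (by norm_num) this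
  have h1 : ((Finset.univ.filter fun x => 99 / 100 ≤ ‖f x‖).card : ℝ) ≤
      ∑ x with ‖f x‖ < 99 / 100, 2 * ‖f x‖ := by
    rw [Finset.sum_filter, ← Equiv.sum_comp (Equiv.mulLeft (x * y)), ← nsmul_one, ← Finset.sum_const,
      Finset.sum_filter]
    refine Finset.sum_le_sum fun s _ => ?_
    by_cases hs : 99 / 100 ≤ ‖f s‖
    · have h2 : 84 / 100 * (99 / 100) - 1 / 10 ≤ ‖f (x * y * s)‖ :=
        hf.le_norm_mul (by norm_num) (by norm_num) (by norm_num) hxy hs (by norm_num)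
      rw [if_pos hs, Equiv.coe_mulLeft, if_pos (hdisj s hs)]
      linarith
    · rw [if_neg hs]
      split_ifs <;> positivity
  rw [← Finset.mul_sum] at h1
  have h3 := hf.sum_norm_filter_lt_le h
  have h4 := hf.le_card_filter_le h
  linarith

/-- The subgroup of the elements on which `f` has absolute value close to `1`. It turns out to be
the centre of the character `f`, see `norm_eq_one_of_mem_nearCenter`. -/
def nearCenter : Subgroup Γ where
  carrier := {x | 96 / 100 ≤ ‖f x‖}
  one_mem' := by
    change 96 / 100 ≤ ‖f 1‖
    rw [hf.one]; norm_num
  mul_mem' hx hy := hf.le_norm_mul_of_le h hx hy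
  inv_mem' {x} hx := by
    change 96 / 100 ≤ ‖f x⁻¹‖
    rw [hf.apply_inv, norm_star]
    exact hx

theorem mem_nearCenter {x : Γ} : x ∈ hf.nearCenter h ↔ 96 / 100 ≤ ‖f x‖ := Iff.rfl

/-- Elements of `nearCenter` translate `f` almost by a scalar. -/
theorem sum_norm_translate_sub_le {k : Γ} (hk : k ∈ hf.nearCenter h) :
    ∑ x, ‖f (k * x) - f k * f x‖ ≤ 3 / 10 * ∑ x, ‖f x‖ ^ 2 := by
  have hN := hf.sum_normSq_pos
  have h1 : ∀ x, ‖f (k * x) - f k * f x‖ ≤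
      (9 / 100 * ‖f x‖ ^ 2 + if ‖f x‖ < 99 / 100 then ‖f x‖ else 0) +
        if ‖f (k * x)‖ < 99 / 100 then ‖f (k * x)‖ else 0 := by
    intro x
    have h0 := norm_nonneg (f x)
    have hk1 := hf.norm_le_one k
    have hi : (0 : ℝ) ≤ if ‖f x‖ < 99 / 100 then ‖f x‖ else 0 := by split_ifs <;> positivity
    have hj : (0 : ℝ) ≤ if ‖f (k * x)‖ < 99 / 100 then ‖f (k * x)‖ else 0 := by
      split_ifs <;> positivity
    by_cases hx : 96 / 100 ≤ ‖f x‖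
    · have h2 := hf.norm_mul_sub_sq_le k x
      have hk0 : 96 / 100 ≤ ‖f k‖ := hk
      have hx1 := hf.norm_le_one x
      have h3 : (1 - ‖f k‖ ^ 2) * (1 - ‖f x‖ ^ 2) ≤ (784 / 10000) * (784 / 10000) := by
        gcongr
        · nlinarith
        · nlinarith
        · nlinarith
      have h4 : ‖f (k * x) - f k * f x‖ ≤ 784 / 10000 :=
        (abs_le_of_sq_le_sq' (by linarith) (by norm_num)).2
      nlinarith
    · have hkx : ¬ 96 / 100 ≤ ‖f (k * x)‖ := fun h2 => hx <| by
        have := (hf.nearCenter h).mul_mem ((hf.nearCenter h).inv_mem hk) h2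
        rwa [inv_mul_cancel_left] at this
      rw [if_pos (by linarith), if_pos (by linarith)]
      have h2 : ‖f (k * x) - f k * f x‖ ≤ ‖f (k * x)‖ + ‖f k * f x‖ := norm_sub_le _ _
      rw [norm_mul] at h2
      nlinarith
  refine (Finset.sum_le_sum fun x _ => h1 x).trans ?_
  rw [Finset.sum_add_distrib, Finset.sum_add_distrib, ← Finset.mul_sum]
  have h2 : ∑ x, (if ‖f (k * x)‖ < 99 / 100 then ‖f (k * x)‖ else 0) =
      ∑ x, if ‖f x‖ < 99 / 100 then ‖f x‖ else 0 :=
    Equiv.sum_comp (Equiv.mulLeft k) fun x => if ‖f x‖ < 99 / 100 then ‖f x‖ else 0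
  rw [h2, ← Finset.sum_filter]
  have h3 := hf.sum_norm_filter_lt_le h
  linarith

end Gap

end IsNormalizedCharacter
end FiniteGroup

/-! ### Minimal central idempotents and the gap in their norms -/

section FiniteGroup

open EllOne

variable {Γ : Type*} [Group Γ] [Fintype Γ] {f : Γ → ℂ}

namespace IsNormalizedCharacter

/-- The minimal central idempotent attached to a normalized character `f`: the multiple
of `f` by `(∑ |f|²)⁻¹`, that is, `χ(1) χ / |Γ|` for `f = χ / χ(1)`. -/
def idempotent {Γ : Type*} [Fintype Γ] (f : Γ → ℂ) : EllOne Γ :=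
  ofFun fun x => ((∑ a, ‖f a‖ ^ 2 : ℝ) : ℂ)⁻¹ * f x

theorem idempotent_apply {Γ : Type*} [Fintype Γ] (f : Γ → ℂ) (x : Γ) :
    idempotent f x = ((∑ a, ‖f a‖ ^ 2 : ℝ) : ℂ)⁻¹ * f x := rfl

variable (hf : IsNormalizedCharacter f)
include hf

theorem norm_idempotent : ‖idempotent f‖ = (∑ a, ‖f a‖ ^ 2)⁻¹ * ∑ a, ‖f a‖ := by
  rw [norm_eq_sum, Finset.mul_sum]
  refine Finset.sum_congr rfl fun x _ => ?_
  rw [idempotent_apply, norm_mul, norm_inv, Complex.norm_real, Real.norm_of_nonneg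
    hf.sum_normSq_pos.le]

theorem idempotent_mem_center : idempotent f ∈ ZEllOne Γ := by
  rw [mem_center_iff]
  intro x g
  rw [idempotent_apply, idempotent_apply, hf.conj]

theorem sum_mul_inv_eq : ∑ a, f a * f a⁻¹ = ((∑ a, ‖f a‖ ^ 2 : ℝ) : ℂ) := by
  rw [Complex.ofReal_sum]
  refine Finset.sum_congr rfl fun a _ => ?_
  rw [hf.apply_inv, Complex.ofReal_pow]
  exact Complex.mul_conj' _

theorem sum_idempotent_mul {g : Γ → ℂ} (hg : ∀ x y, g (y * x * y⁻¹) = g x) (x : Γ) :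
    ∑ y, idempotent f y * g (y⁻¹ * x) = (∑ a, g a * f a⁻¹) * idempotent f x := by
  have h := hf.sum_mul_class hg x
  have h1 : ∑ y, f y * g (y⁻¹ * x) = ∑ a, f (x * a⁻¹) * g a := by
    rw [← Equiv.sum_comp ((Equiv.inv Γ).trans (Equiv.mulLeft x)) fun y => f y * g (y⁻¹ * x)]
    simp
  simp only [idempotent_apply, mul_assoc]
  rw [← Finset.mul_sum, mul_left_comm, mul_comm _ (f x), h1, h]
  simp only [mul_comm (g _)]

theorem idempotent_mul (g : ZEllOne Γ) :
    idempotent f * (g : EllOne Γ) = (∑ a, (g : EllOne Γ) a * f a⁻¹) • idempotent f := by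
  ext x
  rw [mul_apply_fintype, hf.sum_idempotent_mul ((mem_center_iff _).1 g.2)]
  simp

theorem idempotent_mul_self : idempotent f * idempotent f = idempotent f := by
  have h := hf.idempotent_mul ⟨_, hf.idempotent_mem_center⟩
  rw [h]
  simp only [idempotent_apply, mul_assoc]
  rw [← Finset.mul_sum, hf.sum_mul_inv_eq,
    inv_mul_cancel₀ (Complex.ofReal_ne_zero.2 hf.sum_normSq_pos.ne'), one_smul]

theorem idempotent_comm (g : EllOne Γ) : idempotent f * g = g * idempotent f :=
  (Subalgebra.mem_center_iff.1 hf.idempotent_mem_center g).symm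

section Gap

variable (h : ∑ x, ‖f x‖ ≤ (1 + 1 / 1000) * ∑ x, ‖f x‖ ^ 2)
include h

theorem norm_delta_mul_idempotent_sub_le {k : Γ} (hk : k ∈ hf.nearCenter h) :
    ‖delta k * idempotent f - f k⁻¹ • idempotent f‖ ≤ 3 / 10 := by
  have hN := hf.sum_normSq_pos
  have h1 := hf.sum_norm_translate_sub_le h ((hf.nearCenter h).inv_mem hk)
  rw [norm_eq_sum]
  have h2 : ∀ x, ‖(delta k * idempotent f - f k⁻¹ • idempotent f) x‖ =
      (∑ a, ‖f a‖ ^ 2)⁻¹ * ‖f (k⁻¹ * x) - f k⁻¹ * f x‖ := by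
    intro x
    rw [lp.coeFn_sub, Pi.sub_apply, lp.coeFn_smul, Pi.smul_apply, delta_mul_apply, smul_eq_mul,
      idempotent_apply, idempotent_apply, mul_left_comm, ← mul_sub, norm_mul, norm_inv,
      Complex.norm_real, Real.norm_of_nonneg hN.le]
  simp only [h2]
  rw [← Finset.mul_sum, inv_mul_le_iff₀ hN]
  linarith

/-- Conjugation by an element of `nearCenter` is close to the identity on the ideal generated by the
idempotent of `f`: both one-sided multiplications are almost scalar, and the scalars almost cancel. -/
theorem norm_conj_sub_le {k : Γ} (hk : k ∈ hf.nearCenter h) {g : EllOne Γ}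
    (hg : idempotent f * g = g) :
    ‖delta k * g * delta k⁻¹ - g‖ ≤ 7 / 10 * ‖g‖ := by
  have hg' : g * idempotent f = g := by rw [← hf.idempotent_comm, hg]
  have h1 := hf.norm_delta_mul_idempotent_sub_le h hk
  have h2 := hf.norm_delta_mul_idempotent_sub_le h ((hf.nearCenter h).inv_mem hk)
  rw [inv_inv] at h2
  have hid : delta k * g * delta k⁻¹ - g =
      (delta k * idempotent f - f k⁻¹ • idempotent f) * (g * delta k⁻¹) +
        f k⁻¹ • (g * (delta k⁻¹ * idempotent f - f k • idempotent f)) + (f k⁻¹ * f k - 1) • g := by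
    have e1 : delta k * idempotent f * (g * delta k⁻¹) = delta k * g * delta k⁻¹ := by
      rw [mul_assoc, ← mul_assoc (idempotent f), hg, ← mul_assoc]
    have e2 : idempotent f * (g * delta k⁻¹) = g * delta k⁻¹ := by rw [← mul_assoc, hg]
    have e3 : g * (delta k⁻¹ * idempotent f) = g * delta k⁻¹ := by
      rw [← hf.idempotent_comm, ← mul_assoc, hg']
    rw [sub_mul, mul_sub, smul_mul_assoc, mul_smul_comm, e1, e2, e3, hg', smul_sub, smul_smul,
      sub_smul, one_smul]
    abel
  have hk0 : 96 / 100 ≤ ‖f k‖ := hk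
  have hk1 := hf.norm_le_one k
  have h3 : ‖f k⁻¹ * f k - 1‖ ≤ 784 / 10000 := by
    have : f k⁻¹ * f k - 1 = ((‖f k‖ ^ 2 - 1 : ℝ) : ℂ) := by
      rw [hf.apply_inv, Complex.ofReal_sub, Complex.ofReal_pow, Complex.ofReal_one]
      congr 1
      exact Complex.conj_mul' _
    rw [this, Complex.norm_real, Real.norm_of_nonpos (by nlinarith)]
    nlinarith
  have hg0 := norm_nonneg g
  have b1 : ‖(delta k * idempotent f - f k⁻¹ • idempotent f) * (g * delta k⁻¹)‖ ≤
      3 / 10 * ‖g‖ := by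
    refine (norm_mul_le _ _).trans ?_
    have : ‖g * delta k⁻¹‖ ≤ ‖g‖ := by simpa [norm_delta] using norm_mul_le g (delta k⁻¹)
    gcongr
  have b2 : ‖f k⁻¹ • (g * (delta k⁻¹ * idempotent f - f k • idempotent f))‖ ≤ 3 / 10 * ‖g‖ := by
    rw [norm_smul]
    have hm := norm_mul_le g (delta k⁻¹ * idempotent f - f k • idempotent f)
    calc _ ≤ 1 * (‖g‖ * (3 / 10)) := by
          gcongr
          · exact hf.norm_le_one _
          · exact hm.trans (by gcongr)
      _ = _ := by ring
  have b3 : ‖(f k⁻¹ * f k - 1) • g‖ ≤ 784 / 10000 * ‖g‖ := by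
    rw [norm_smul]; gcongr
  rw [hid]
  refine (norm_add₃_le).trans ?_
  linarith

/-- A group of operators uniformly close to the identity is trivial: the average `P` of the
conjugations is a projection with `‖P g - g‖ ≤ 7/10 ‖g‖`, hence the identity. -/
theorem delta_conj_eq {k : Γ} (hk : k ∈ hf.nearCenter h) {g : EllOne Γ}
    (hg : idempotent f * g = g) : delta k * g * delta k⁻¹ = g := by
  classical
  let M := hf.nearCenter h
  have hM0 : (Fintype.card M : ℂ) ≠ 0 := Fintype.card_group_complex_ne_zero M
  let P : EllOne Γ → EllOne Γ := fun g =>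
    (Fintype.card M : ℂ)⁻¹ • ∑ k : M, delta (k : Γ) * g * delta (k : Γ)⁻¹
  have hinv : ∀ (g : EllOne Γ) (k : M), delta (k : Γ) * P g * delta (k : Γ)⁻¹ = P g := by
    intro g k
    simp only [P]
    rw [mul_smul_comm, smul_mul_assoc, Finset.mul_sum, Finset.sum_mul]
    congr 1
    rw [← Equiv.sum_comp (Equiv.mulLeft k) fun l : M => delta (l : Γ) * g * delta (l : Γ)⁻¹]
    refine Finset.sum_congr rfl fun l _ => ?_
    simp only [Equiv.coe_mulLeft, Subgroup.coe_mul, mul_inv_rev, ← delta_mul_delta, mul_assoc]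
  have hPP : ∀ g, P (P g) = P g := by
    intro g
    change (Fintype.card M : ℂ)⁻¹ • ∑ k : M, delta (k : Γ) * P g * delta (k : Γ)⁻¹ = P g
    simp only [hinv]
    rw [Finset.sum_const, Finset.card_univ, ← Nat.cast_smul_eq_nsmul ℂ, smul_smul,
      inv_mul_cancel₀ hM0, one_smul]
  have hPsub : ∀ g g', P (g - g') = P g - P g' := by
    intro g g'
    simp only [P, mul_sub, sub_mul, Finset.sum_sub_distrib, smul_sub]
  have hPe : ∀ g, idempotent f * g = g → idempotent f * P g = P g := by
    intro g hg
    simp only [P]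
    rw [mul_smul_comm, Finset.mul_sum]
    congr 1
    refine Finset.sum_congr rfl fun l _ => ?_
    rw [← mul_assoc, ← mul_assoc, hf.idempotent_comm, mul_assoc (delta _), hg]
  have hPn : ∀ g, idempotent f * g = g → ‖P g - g‖ ≤ 7 / 10 * ‖g‖ := by
    intro g hg
    have : P g - g = (Fintype.card M : ℂ)⁻¹ •
        ∑ k : M, (delta (k : Γ) * g * delta (k : Γ)⁻¹ - g) := by
      rw [Finset.sum_sub_distrib, smul_sub, Finset.sum_const, Finset.card_univ,
        ← Nat.cast_smul_eq_nsmul ℂ, smul_smul, inv_mul_cancel₀ hM0, one_smul]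
    rw [this, norm_smul, norm_inv, Complex.norm_natCast,
      inv_mul_le_iff₀ (Fintype.card_group_real_pos M)]
    refine (norm_sum_le _ _).trans ((Finset.sum_le_card_nsmul _ _ _ fun l _ =>
      hf.norm_conj_sub_le h l.2 hg).trans ?_)
    rw [nsmul_eq_mul, Finset.card_univ]
  -- `P` vanishes on `P g - g` and moves elements of the ideal by a small proportion only.
  have h0 : P g - g = 0 := by
    have h1 := hPn (P g - g) (by rw [mul_sub, hPe g hg, hg])
    rw [hPsub, hPP, sub_self, zero_sub, norm_neg] at h1
    rw [← norm_le_zero_iff]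
    linarith [norm_nonneg (P g - g)]
  rw [← sub_eq_zero.1 h0]
  exact hinv g ⟨k, hk⟩

/-- Centrality of `k` modulo the idempotent makes `f` equal to `1` on commutators with `k`, and the
product formula turns this into `‖f k‖ ^ 2 = 1`. -/
theorem norm_eq_one_of_mem_nearCenter {k : Γ} (hk : k ∈ hf.nearCenter h) : ‖f k‖ = 1 := by
  have hN : ((∑ a, ‖f a‖ ^ 2 : ℝ) : ℂ) ≠ 0 := Complex.ofReal_ne_zero.2 hf.sum_normSq_pos.ne'
  have h1 : ∀ g, f (k⁻¹ * (g * k * g⁻¹)) = 1 := by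
    intro g
    have h2 := hf.delta_conj_eq h hk (g := delta g * idempotent f)
      (by rw [hf.idempotent_comm, mul_assoc, hf.idempotent_mul_self])
    rw [← mul_assoc, mul_assoc, hf.idempotent_comm, ← mul_assoc, delta_mul_delta,
      delta_mul_delta] at h2
    have h3 := congrArg (fun F : EllOne Γ => F g) h2
    simp only [delta_mul_apply, idempotent_apply, inv_mul_cancel, hf.one] at h3
    have h4 := mul_left_cancel₀ (inv_ne_zero hN) h3
    have h5 : (k * g * k⁻¹)⁻¹ * g = k * g⁻¹ * (k⁻¹ * g) := by group
    rw [h5, hf.mul_comm_arg, mul_assoc, ← mul_assoc g] at h4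
    exact h4
  have h5 := hf.sum_conj k⁻¹ k
  simp only [h1, Finset.sum_const, Finset.card_univ, nsmul_eq_mul] at h5
  have h6 := mul_left_cancel₀ (Fintype.card_group_complex_ne_zero Γ) h5
  have h7 := congrArg norm h6
  rw [norm_one, norm_mul, hf.apply_inv, norm_star] at h7
  nlinarith [norm_nonneg (f k)]

/-- If the minimal central idempotent of `f` has norm close to `1`, then `f` takes only values of
absolute value `0` and `1`: it vanishes outside a subgroup on which it is a linear character. -/
theorem sum_norm_eq_of_le : ∑ x, ‖f x‖ = ∑ x, ‖f x‖ ^ 2 := by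
  classical
  set M := hf.nearCenter h
  have hN := hf.sum_normSq_pos
  set N := ∑ x, ‖f x‖ ^ 2 with hNdef
  have hMn : ∀ {x}, x ∈ M → ‖f x‖ = 1 := fun hx => hf.norm_eq_one_of_mem_nearCenter h hx
  have hmul : ∀ {x : Γ}, x ∈ M → ∀ y, f (x * y) = f x * f y := by
    intro x hx y
    have := hf.norm_mul_sub_sq_le x y
    rw [hMn hx, one_pow, sub_self, zero_mul] at this
    have h2 : ‖f (x * y) - f x * f y‖ = 0 := by
      nlinarith [norm_nonneg (f (x * y) - f x * f y)]
    exact sub_eq_zero.1 (norm_eq_zero.1 h2)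
  set m : ℝ := ∑ x, if x ∈ M then 1 else 0 with hm
  have hm1 : m ≤ N := by
    refine Finset.sum_le_sum fun x _ => ?_
    split_ifs with hx
    · rw [hMn hx, one_pow]
    · positivity
  have hm2 : 9 / 10 * N ≤ m := by
    refine (hf.le_card_filter_le h).trans ?_
    rw [← nsmul_one, ← Finset.sum_const, Finset.sum_filter]
    refine Finset.sum_le_sum fun x _ => ?_
    by_cases hx : 99 / 100 ≤ ‖f x‖
    · rw [if_pos hx, if_pos ((hf.mem_nearCenter h).2 (by linarith))]
    · rw [if_neg hx]; split_ifs <;> norm_num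
  have hm0 : 0 < m := by linarith
  -- The idempotent of the linear character `f` of the subgroup `M`.
  let q : EllOne Γ := ofFun fun x => if x ∈ M then (m : ℂ)⁻¹ * f x else 0
  have hqv : ∀ (v : EllOne Γ), (∀ x ∈ M, ∀ y, v (x⁻¹ * y) = star (f x) * v y) → q * v = v := by
    intro v hv
    ext y
    rw [mul_apply_fintype]
    have : ∀ x, q x * v (x⁻¹ * y) = (m : ℂ)⁻¹ * (((if x ∈ M then 1 else 0 : ℝ) : ℂ) * v y) := by
      intro x
      simp only [q, ofFun_apply]
      split_ifs with hx
      · have h1 : f x * star (f x) = 1 := by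
          have := Complex.mul_conj' (f x)
          rw [hMn hx] at this
          simpa using this
        rw [hv x hx, Complex.ofReal_one]
        linear_combination ((m : ℂ)⁻¹ * v y) * h1
      · simp
    simp only [this]
    rw [← Finset.mul_sum, ← Finset.sum_mul, ← Complex.ofReal_sum, ← hm,
      inv_mul_cancel_left₀ (Complex.ofReal_ne_zero.2 hm0.ne')]
  have hqe : q * idempotent f = idempotent f := hqv _ fun x hx y => by
    rw [idempotent_apply, idempotent_apply, hmul (M.inv_mem hx), hf.apply_inv]
    ring
  have hqq : q * q = q := hqv _ fun x hx y => by
    have : x⁻¹ * y ∈ M ↔ y ∈ M := M.mul_mem_cancel_left (M.inv_mem hx)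
    simp only [q, ofFun_apply, this]
    split_ifs
    · rw [hmul (M.inv_mem hx), hf.apply_inv]; ring
    · simp
  have hd : (q - idempotent f) * (q - idempotent f) = q - idempotent f := by
    rw [sub_mul, mul_sub, mul_sub, hqq, hqe, hf.idempotent_comm q, hqe, hf.idempotent_mul_self]
    abel
  -- An idempotent of norm less than `1` vanishes.
  have hdn : ‖q - idempotent f‖ < 1 := by
    rw [norm_eq_sum]
    have hb : ∀ x, ‖(q - idempotent f) x‖ ≤ (m⁻¹ - N⁻¹) * (if x ∈ M then 1 else 0) +
        N⁻¹ * (if ‖f x‖ < 99 / 100 then ‖f x‖ else 0) := by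
      intro x
      have hi : (0 : ℝ) ≤ N⁻¹ * if ‖f x‖ < 99 / 100 then ‖f x‖ else 0 := by
        split_ifs <;> positivity
      rw [lp.coeFn_sub, Pi.sub_apply, idempotent_apply, ← hNdef]
      simp only [q, ofFun_apply]
      by_cases hx : x ∈ M
      · have hs : ‖(m : ℂ)⁻¹ * f x - (N : ℂ)⁻¹ * f x‖ = m⁻¹ - N⁻¹ := by
          rw [← sub_mul, norm_mul, hMn hx, mul_one, ← Complex.ofReal_inv,
            ← Complex.ofReal_inv, ← Complex.ofReal_sub, Complex.norm_real, Real.norm_of_nonneg]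
          exact sub_nonneg.2 (by gcongr)
        rw [if_pos hx, if_pos hx, hs]
        linarith
      · have hx' : ‖f x‖ < 99 / 100 := by
          by_contra! hc
          exact hx ((hf.mem_nearCenter h).2 (by linarith))
        rw [if_neg hx, if_neg hx, if_pos hx', zero_sub, norm_neg, norm_mul, norm_inv,
          Complex.norm_real, Real.norm_of_nonneg hN.le]
        linarith
    refine (Finset.sum_le_sum fun x _ => hb x).trans_lt ?_
    rw [Finset.sum_add_distrib, ← Finset.mul_sum, ← Finset.mul_sum, ← hm, ← Finset.sum_filter]
    have h3 := hf.sum_norm_filter_lt_le h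
    rw [← hNdef] at h3
    have h4 : N⁻¹ * ∑ x with ‖f x‖ < 99 / 100, ‖f x‖ ≤ 1 / 10 := by
      rw [inv_mul_le_iff₀ hN]; linarith
    have h5 : 9 / 10 ≤ N⁻¹ * m := by
      rw [le_inv_mul_iff₀ hN]; linarith
    rw [sub_mul, inv_mul_cancel₀ hm0.ne']
    linarith
  have hq0 : q = idempotent f := by
    have h6 := norm_mul_le (q - idempotent f) (q - idempotent f)
    rw [hd] at h6
    rw [← sub_eq_zero, ← norm_le_zero_iff]
    nlinarith [norm_nonneg (q - idempotent f)]
  refine Finset.sum_congr rfl fun x _ => ?_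
  by_cases hx : x ∈ M
  · rw [hMn hx, one_pow]
  · have h7 := congrArg (fun F : EllOne Γ => F x) hq0
    simp only [q, ofFun_apply, if_neg hx, idempotent_apply, zero_eq_mul, inv_eq_zero,
      Complex.ofReal_eq_zero] at h7
    rcases h7 with h7 | h7
    · exact absurd h7 hN.ne'
    · rw [h7]; simp

end Gap

end IsNormalizedCharacter
end FiniteGroup

/-! ### One factor of a restricted direct product -/

open EllOne

theorem RDP.commute_incl {I : Type*} {G : I → Type*} [∀ i, Group (G i)] {i : I} {y : RDP G}
    (hy : (y : ∀ j, G j) i = 1) (a : G i) : RDP.incl i a * y = y * RDP.incl i a := by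
  have := RDP.incl_conj i a y
  rw [hy, one_mul, inv_one, mul_one, mul_inv_eq_iff_eq_mul] at this
  exact this.symm

theorem EllOne.extend_mul_apply {H K : Type*} [Group H] [Fintype H] [Group K] (φ : H →* K)
    (hφ : Function.Injective φ) (u : EllOne H) (F : EllOne K) (x : K) :
    (extend φ hφ u * F) x = ∑ a, u a * F ((φ a)⁻¹ * x) := by
  rw [mul_apply, ← hφ.tsum_eq]
  · rw [tsum_fintype]
    simp only [extend_apply, hφ.extend_apply]
  · intro y hy
    by_contra hn
    exact hy (by simp [extend_apply, Function.extend_apply' _ _ _ hn])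

theorem EllOne.norm_extend {H K : Type*} [Group H] [Group K] (φ : H →* K)
    (hφ : Function.Injective φ) (u : EllOne H) : ‖extend φ hφ u‖ = ‖u‖ := by
  rw [norm_eq, norm_eq, ← hφ.tsum_eq]
  · simp only [extend_apply, hφ.extend_apply]
  · intro y hy
    by_contra hn
    exact hy (by simp [extend_apply, Function.extend_apply' _ _ _ hn])

section Factor

variable {I : Type*} {G : I → Type*} [∀ i, Group (G i)]

/-- `F` is supported on the elements whose entry at `i` is trivial. -/
def TrivialAt (F : ZEllOne (RDP G)) (i : I) : Prop :=
  ∀ x : RDP G, (x : ∀ j, G j) i ≠ 1 → (F : EllOne (RDP G)) x = 0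

theorem TrivialAt.eq_smul_one {F : ZEllOne (RDP G)} (h : ∀ i, TrivialAt F i) :
    F = (F : EllOne (RDP G)) 1 • (1 : ZEllOne (RDP G)) := by
  apply Subtype.ext
  ext x
  rw [SetLike.val_smul, lp.coeFn_smul, Pi.smul_apply, OneMemClass.coe_one, one_def, delta_apply]
  by_cases hx : x = 1
  · simp [hx]
  · obtain ⟨i, hi⟩ : ∃ i, (x : ∀ j, G j) i ≠ 1 := by
      by_contra! hc
      exact hx (Subtype.ext (funext hc))
    rw [if_neg hx, h i x hi, smul_zero]

theorem norm_zincl (i : I) (u : ZEllOne (G i)) : ‖RDP.zincl i u‖ = ‖u‖ :=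
  norm_extend _ (RDP.incl_injective i) _

variable [∀ i, Fintype (G i)]

theorem zincl_mul_apply (i : I) (u : ZEllOne (G i)) (F : ZEllOne (RDP G)) (x : RDP G) :
    ((RDP.zincl i u * F : ZEllOne (RDP G)) : EllOne (RDP G)) x =
      ∑ a, (u : EllOne (G i)) a * (F : EllOne (RDP G)) ((RDP.incl i a)⁻¹ * x) :=
  extend_mul_apply _ (RDP.incl_injective i) _ _ _

theorem TrivialAt.zincl_mul {i j : I} (hij : j ≠ i) (u : ZEllOne (G i)) {F : ZEllOne (RDP G)}
    (hF : TrivialAt F j) : TrivialAt (RDP.zincl i u * F) j := by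
  intro x hx
  rw [zincl_mul_apply]
  refine Finset.sum_eq_zero fun a _ => ?_
  rw [hF, mul_zero]
  simpa [RDP.incl_ne hij] using hx

theorem TrivialAt.zincl_mul_apply {i : I} (u : ZEllOne (G i)) {F : ZEllOne (RDP G)}
    (hF : TrivialAt F i) (x : RDP G) :
    ((RDP.zincl i u * F : ZEllOne (RDP G)) : EllOne (RDP G)) x =
      (u : EllOne (G i)) ((x : ∀ j, G j) i) *
        (F : EllOne (RDP G)) ((RDP.incl i ((x : ∀ j, G j) i))⁻¹ * x) := by
  rw [_root_.zincl_mul_apply, Finset.sum_eq_single ((x : ∀ j, G j) i)]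
  · intro a _ ha
    rw [hF, mul_zero]
    simp only [Subgroup.coe_mul, InvMemClass.coe_inv, Pi.mul_apply, Pi.inv_apply, RDP.incl_same,
      ne_eq, inv_mul_eq_one]
    exact ha
  · simp

/-- Norms are multiplicative across complementary factors. -/
theorem TrivialAt.norm_zincl_mul {i : I} (u : ZEllOne (G i)) {F : ZEllOne (RDP G)}
    (hF : TrivialAt F i) : ‖RDP.zincl i u * F‖ = ‖u‖ * ‖F‖ := by
  have hs : ∀ a : G i, Summable fun x : RDP G => ‖(u : EllOne (G i)) a‖ *
      ‖(F : EllOne (RDP G)) ((RDP.incl i a)⁻¹ * x)‖ := fun a =>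
    ((summable_norm (F : EllOne (RDP G))).comp_injective
      (mul_right_injective (RDP.incl i a)⁻¹)).mul_left _
  have h1 : ∀ x : RDP G, ‖((RDP.zincl i u * F : ZEllOne (RDP G)) : EllOne (RDP G)) x‖ =
      ∑ a, ‖(u : EllOne (G i)) a‖ * ‖(F : EllOne (RDP G)) ((RDP.incl i a)⁻¹ * x)‖ := by
    intro x
    rw [hF.zincl_mul_apply, norm_mul, Finset.sum_eq_single ((x : ∀ j, G j) i)]
    · intro a _ ha
      rw [hF, norm_zero, mul_zero]
      simp only [Subgroup.coe_mul, InvMemClass.coe_inv, Pi.mul_apply, Pi.inv_apply, RDP.incl_same,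
        ne_eq, inv_mul_eq_one]
      exact ha
    · simp
  have h2 : ‖RDP.zincl i u * F‖ =
      ∑' x, ‖((RDP.zincl i u * F : ZEllOne (RDP G)) : EllOne (RDP G)) x‖ := norm_eq _
  have h3 : ‖F‖ = ∑' x, ‖(F : EllOne (RDP G)) x‖ := norm_eq _
  have h4 : ‖u‖ = ∑ x, ‖(u : EllOne (G i)) x‖ := norm_eq_sum _
  rw [h2, h3, h4, Finset.sum_mul]
  simp only [h1]
  rw [Summable.tsum_finsetSum fun a _ => hs a]
  refine Finset.sum_congr rfl fun a _ => ?_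
  rw [tsum_mul_left]
  congr 1
  exact (Equiv.mulLeft (RDP.incl i a)⁻¹).tsum_eq fun x => ‖(F : EllOne (RDP G)) x‖

open Classical in
/-- Integration over the `i`-th coordinate against a class function `k`:
`x ↦ ∑_a F(a x) k(a⁻¹)`, for `x` with trivial entry at `i`. -/
def integrateAt (i : I) {k : G i → ℂ} (hk : ∀ x g, k (g * x * g⁻¹) = k x)
    (F : ZEllOne (RDP G)) : ZEllOne (RDP G) :=
  ⟨⟨fun x => if (x : ∀ j, G j) i = 1 then
      ∑ a, (F : EllOne (RDP G)) (RDP.incl i a * x) * k a⁻¹ else 0, by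
    refine (memlp_iff _).2 ?_
    have hs : Summable fun x : RDP G =>
        ∑ a, ‖(F : EllOne (RDP G)) (RDP.incl i a * x)‖ * ‖k a⁻¹‖ :=
      summable_sum fun a _ => ((summable_norm (F : EllOne (RDP G))).comp_injective
        (mul_right_injective (RDP.incl i a))).mul_right _
    refine Summable.of_nonneg_of_le (fun _ => norm_nonneg _) (fun x => ?_) hs
    split_ifs
    · refine (norm_sum_le _ _).trans (le_of_eq ?_)
      simp only [norm_mul]
    · rw [norm_zero]; positivity⟩, by
    rw [mem_center_iff]
    intro x g
    have hF := (mem_center_iff _).1 F.2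
    have h1 : ((g * x * g⁻¹ : RDP G) : ∀ j, G j) i = 1 ↔ (x : ∀ j, G j) i = 1 := by
      simp
    change (if ((g * x * g⁻¹ : RDP G) : ∀ j, G j) i = 1 then _ else _) = ite _ _ _
    simp only [h1]
    refine if_congr Iff.rfl ?_ rfl
    rw [← Equiv.sum_comp (MulAut.conj ((g : ∀ j, G j) i)).toEquiv]
    refine Finset.sum_congr rfl fun a _ => ?_
    simp only [MulEquiv.toEquiv_eq_coe, MulEquiv.coe_toEquiv, MulAut.conj_apply]
    have h2 : g * RDP.incl i a * g⁻¹ * (g * x * g⁻¹) = g * (RDP.incl i a * x) * g⁻¹ := by group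
    have h3 : ((g : ∀ j, G j) i * a * ((g : ∀ j, G j) i)⁻¹)⁻¹ =
        (g : ∀ j, G j) i * a⁻¹ * ((g : ∀ j, G j) i)⁻¹ := by group
    rw [← RDP.incl_conj, h2, hF, h3, hk]⟩

theorem integrateAt_apply (i : I) {k : G i → ℂ} (hk : ∀ x g, k (g * x * g⁻¹) = k x)
    (F : ZEllOne (RDP G)) {x : RDP G} (hx : (x : ∀ j, G j) i = 1) :
    (integrateAt i hk F : EllOne (RDP G)) x =
      ∑ a, (F : EllOne (RDP G)) (RDP.incl i a * x) * k a⁻¹ := if_pos hx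

theorem trivialAt_integrateAt (i : I) {k : G i → ℂ} (hk : ∀ x g, k (g * x * g⁻¹) = k x)
    (F : ZEllOne (RDP G)) : TrivialAt (integrateAt i hk F) i := fun _ hx => if_neg hx

theorem TrivialAt.integrateAt {i j : I} {k : G i → ℂ} (hk : ∀ x g, k (g * x * g⁻¹) = k x)
    {F : ZEllOne (RDP G)} (hF : TrivialAt F j) : TrivialAt (integrateAt i hk F) j := by
  intro x hx
  by_cases hxi : (x : ∀ j, G j) i = 1
  · have hij : j ≠ i := by rintro rfl; exact hx hxi
    rw [integrateAt_apply i hk F hxi]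
    refine Finset.sum_eq_zero fun a _ => ?_
    rw [hF, zero_mul]
    simpa [RDP.incl_ne hij] using hx
  · exact trivialAt_integrateAt i hk F x hxi

variable {f : ∀ i, G i → ℂ} (hf : ∀ i, IsNormalizedCharacter (f i))

/-- The minimal central idempotent of the factor `G i`, inside `Zℓ¹(⨁ G)`. -/
def factorIdempotent (i : I) : ZEllOne (RDP G) :=
  RDP.zincl i ⟨IsNormalizedCharacter.idempotent (f i), (hf i).idempotent_mem_center⟩

/-- Multiplication by the idempotent of the factor `G i` only sees the `i`-th coordinate through
integration against the normalized character. -/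
theorem factorIdempotent_mul (i : I) (F : ZEllOne (RDP G)) :
    factorIdempotent hf i * F =
      factorIdempotent hf i * integrateAt i (fun x g => (hf i).conj g x) F := by
  apply Subtype.ext
  ext x
  have hF := (mem_center_iff _).1 F.2
  rw [factorIdempotent, (trivialAt_integrateAt i _ F).zincl_mul_apply, zincl_mul_apply]
  set y := (RDP.incl i ((x : ∀ j, G j) i))⁻¹ * x with hy
  have hyi : (y : ∀ j, G j) i = 1 := by simp [hy, RDP.incl_same]
  rw [integrateAt_apply i _ F hyi]
  have hx : x = RDP.incl i ((x : ∀ j, G j) i) * y := by rw [hy, mul_inv_cancel_left]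
  have h1 : ∀ a, (RDP.incl i a)⁻¹ * x = RDP.incl i (a⁻¹ * (x : ∀ j, G j) i) * y := by
    intro a
    conv_lhs => rw [hx]
    rw [map_mul, map_inv, mul_assoc]
  simp only [h1]
  have hcl : ∀ c g, (F : EllOne (RDP G)) (RDP.incl i (g * c * g⁻¹) * y) =
      (F : EllOne (RDP G)) (RDP.incl i c * y) := by
    intro c g
    rw [← hF (RDP.incl i c * y) (RDP.incl i g)]
    rw [map_mul, map_mul, mul_assoc, RDP.commute_incl hyi, map_inv]
    simp only [mul_assoc]
  have h2 := (hf i).sum_idempotent_mul (g := fun c => (F : EllOne (RDP G)) (RDP.incl i c * y))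
    hcl ((x : ∀ j, G j) i)
  refine h2.trans (mul_comm _ _)

end Factor

/-! ### Products of factor idempotents and the approximate identity -/

section Products

variable {I : Type*} {G : I → Type*} [∀ i, Group (G i)] [∀ i, Fintype (G i)]
  {f : ∀ i, G i → ℂ} (hf : ∀ i, IsNormalizedCharacter (f i))

theorem TrivialAt.prod_factorIdempotent_mul {T : Finset I} {j : I} (hj : j ∉ T)
    {F : ZEllOne (RDP G)} (hF : TrivialAt F j) :
    TrivialAt ((∏ i ∈ T, factorIdempotent hf i) * F) j := by
  classical
  induction T using Finset.induction_on with
  | empty => simpa using hF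
  | insert i T hi ih =>
    rw [Finset.prod_insert hi, mul_assoc]
    rw [Finset.mem_insert, not_or] at hj
    exact (ih hj.2).zincl_mul hj.1 _

/-- Modulo the idempotent of the factors in `T`, every element is trivial at all of `T`. -/
theorem exists_prod_factorIdempotent_mul_eq (T : Finset I) (F : ZEllOne (RDP G)) :
    ∃ W : ZEllOne (RDP G),
      (∏ i ∈ T, factorIdempotent hf i) * F = (∏ i ∈ T, factorIdempotent hf i) * W ∧
      (∀ j ∈ T, TrivialAt W j) ∧ ∀ j, TrivialAt F j → TrivialAt W j := by
  classical
  induction T using Finset.induction_on with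
  | empty => exact ⟨F, rfl, by simp, fun _ h => h⟩
  | insert i T hi ih =>
    obtain ⟨W, hW, h1, h2⟩ := ih
    refine ⟨integrateAt i (fun x g => (hf i).conj g x) W, ?_, ?_, fun j hj => ?_⟩
    · rw [Finset.prod_insert hi, mul_assoc, hW, mul_left_comm, factorIdempotent_mul hf i W]
      ring
    · intro j hj
      rcases Finset.mem_insert.1 hj with rfl | hj
      · exact trivialAt_integrateAt _ _ _
      · exact (h1 j hj).integrateAt _
    · exact (h2 j hj).integrateAt _

theorem norm_prod_factorIdempotent_mul (T : Finset I) {W : ZEllOne (RDP G)}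
    (hW : ∀ j ∈ T, TrivialAt W j) :
    ‖(∏ i ∈ T, factorIdempotent hf i) * W‖ =
      (∏ i ∈ T, ‖IsNormalizedCharacter.idempotent (f i)‖) * ‖W‖ := by
  classical
  induction T using Finset.induction_on with
  | empty => simp
  | insert i T hi ih =>
    have h1 := (hW i (Finset.mem_insert_self i T)).prod_factorIdempotent_mul hf hi
    rw [Finset.prod_insert hi, Finset.prod_insert hi, mul_assoc, mul_assoc,
      ← ih fun j hj => hW j (Finset.mem_insert_of_mem hj)]
    exact h1.norm_zincl_mul _

end Products

section Truncation

variable {I : Type*} {G : I → Type*} [∀ i, Group (G i)]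

/-- The restriction of `F` to the elements that are trivial outside `T`. -/
def truncate (T : Finset I) (F : ZEllOne (RDP G)) : ZEllOne (RDP G) :=
  ⟨⟨{x : RDP G | ∀ j ∉ T, (x : ∀ j, G j) j = 1}.indicator (F : EllOne (RDP G)),
    (memlp_iff _).2 (Summable.of_nonneg_of_le (fun _ => norm_nonneg _)
      (fun _ => norm_indicator_le_norm_self _ _) (summable_norm (F : EllOne (RDP G))))⟩, by
    rw [mem_center_iff]
    intro x g
    have h1 : g * x * g⁻¹ ∈ {x : RDP G | ∀ j ∉ T, (x : ∀ j, G j) j = 1} ↔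
        x ∈ {x : RDP G | ∀ j ∉ T, (x : ∀ j, G j) j = 1} := by simp
    change Set.indicator _ _ (g * x * g⁻¹) = Set.indicator _ _ x
    classical
    rw [Set.indicator_apply, Set.indicator_apply]
    exact if_congr h1 ((mem_center_iff _).1 F.2 x g) rfl⟩

theorem truncate_apply (T : Finset I) (F : ZEllOne (RDP G)) (x : RDP G) :
    (truncate T F : EllOne (RDP G)) x =
      {x : RDP G | ∀ j ∉ T, (x : ∀ j, G j) j = 1}.indicator (F : EllOne (RDP G)) x := rfl

theorem trivialAt_truncate {T : Finset I} (F : ZEllOne (RDP G)) {j : I} (hj : j ∉ T) :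
    TrivialAt (truncate T F) j := by
  intro x hx
  rw [truncate_apply, Set.indicator_of_notMem]
  intro h
  exact hx (h j hj)

theorem tendsto_norm_sub_truncate (F : ZEllOne (RDP G)) :
    Tendsto (fun T : Finset I => ‖F - truncate T F‖) atTop (𝓝 0) := by
  have h1 : ∀ T : Finset I, ‖F - truncate T F‖ =
      ∑' x, ‖(F : EllOne (RDP G)) x - (truncate T F : EllOne (RDP G)) x‖ := fun T => norm_eq _
  simp only [h1]
  rw [← tsum_zero (β := RDP G)]
  refine tendsto_tsum_of_dominated_convergence (summable_norm (F : EllOne (RDP G)))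
    (fun x => ?_) (Eventually.of_forall fun T x => ?_)
  · refine tendsto_const_nhds.congr' ?_
    have hfin : {j | (x : ∀ j, G j) j ≠ 1}.Finite := x.2
    filter_upwards [eventually_ge_atTop hfin.toFinset] with T hT
    rw [truncate_apply, Set.indicator_of_mem, sub_self, norm_zero]
    intro j hj
    by_contra hne
    exact hj (hT (hfin.mem_toFinset.2 hne))
  · rw [norm_norm, truncate_apply]
    classical
    rw [Set.indicator_apply]
    split_ifs <;> simp

end Truncation

section Character

/-- `mul_sub`, for the subtraction that comes from the norm structure. -/
theorem ZEllOne.mul_sub {H : Type*} [Group H] (a b c : ZEllOne H) :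
    a * (b - c) = a * b - a * c :=
  Subtype.ext (_root_.mul_sub (a : EllOne H) b c)


instance {H : Type*} [Group H] : CompleteSpace (ZEllOne H) := by
  have : IsClosed ((ZEllOne H : Subalgebra ℂ (EllOne H)) : Set (EllOne H)) := by
    have h : IsClosed (Set.center (EllOne H)) := by
      rw [← Set.centralizer_univ]
      exact Set.isClosed_centralizer _
    exact h
  exact this.completeSpace_coe

instance {H : Type*} [Group H] : NormOneClass (ZEllOne H) :=
  ⟨norm_delta (1 : H)⟩

theorem norm_algHom_le {H : Type*} [Group H] (ω : ZEllOne H →ₐ[ℂ] ℂ) (F : ZEllOne H) :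
    ‖ω F‖ ≤ ‖F‖ :=
  AlgHom.norm_apply_le_self ω F

end Character

section BoundedApproximateIdentity

variable {I : Type*} {G : I → Type*} [∀ i, Group (G i)] [∀ i, Fintype (G i)]
  {f : ∀ i, G i → ℂ} (hf : ∀ i, IsNormalizedCharacter (f i)) {ω : ZEllOne (RDP G) →ₐ[ℂ] ℂ}
  (hω : ∀ i, ω (factorIdempotent hf i) = 1)
include hω

theorem algHom_prod_factorIdempotent (T : Finset I) :
    ω (∏ i ∈ T, factorIdempotent hf i) = 1 := by
  rw [map_prod, Finset.prod_eq_one fun i _ => hω i]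

/-- Multiplying by the idempotents of `T` an element on which the character is `1` costs at least the
product of their norms: the complementary part still has norm at least `1`. -/
theorem prod_norm_le_norm_mul (T : Finset I) {v : ZEllOne (RDP G)} (hv : ω v = 1) :
    ∏ i ∈ T, ‖IsNormalizedCharacter.idempotent (f i)‖ ≤
      ‖(∏ i ∈ T, factorIdempotent hf i) * v‖ := by
  obtain ⟨W, hW, h1, -⟩ := exists_prod_factorIdempotent_mul_eq hf T v
  have h2 : ω W = 1 := by
    have := congrArg ω hW
    rwa [map_mul, map_mul, algHom_prod_factorIdempotent hf hω, one_mul, one_mul, hv,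
      eq_comm] at this
  have h3 := norm_algHom_le ω W
  rw [h2, norm_one] at h3
  rw [hW, norm_prod_factorIdempotent_mul hf T h1]
  exact le_mul_of_one_le_right (Finset.prod_nonneg fun _ _ => norm_nonneg _) h3

/-- The idempotent of the factors in `T` acts on functions supported on those factors as the
character. -/
theorem prod_factorIdempotent_mul_of_trivialAt (T : Finset I) {F : ZEllOne (RDP G)}
    (hF : ∀ j ∉ T, TrivialAt F j) :
    (∏ i ∈ T, factorIdempotent hf i) * F = ω F • ∏ i ∈ T, factorIdempotent hf i := by
  obtain ⟨W, hW, h1, h2⟩ := exists_prod_factorIdempotent_mul_eq hf T F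
  have h3 : ∀ j, TrivialAt W j := fun j => by
    by_cases hj : j ∈ T
    · exact h1 j hj
    · exact h2 j (hF j hj)
  have h4 : ω F = ω W := by
    have := congrArg ω hW
    rwa [map_mul, map_mul, algHom_prod_factorIdempotent hf hω, one_mul, one_mul] at this
  have h5 := TrivialAt.eq_smul_one h3
  have h6 : ω W = (W : EllOne (RDP G)) 1 := by
    rw [h5, algHom_smul, map_one, mul_one, ← h5]
  rw [hW, h4, h6]
  conv_lhs => rw [h5]
  rw [mul_smul_comm, mul_one]

theorem norm_prod_factorIdempotent_mul_le (T : Finset I) {F : ZEllOne (RDP G)} (hF : ω F = 0) :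
    ‖(∏ i ∈ T, factorIdempotent hf i) * F‖ ≤
      2 * ‖∏ i ∈ T, factorIdempotent hf i‖ * ‖F - truncate T F‖ := by
  set E := ∏ i ∈ T, factorIdempotent hf i with hE
  have h1 : E * F = E * (F - truncate T F) + ω (truncate T F) • E := by
    rw [hE, ← prod_factorIdempotent_mul_of_trivialAt hf hω T
      (fun j hj => trivialAt_truncate F hj), ZEllOne.mul_sub]
    abel
  have h2 : ‖ω (truncate T F)‖ ≤ ‖F - truncate T F‖ := by
    have := norm_algHom_le ω (F - truncate T F)
    rwa [map_sub, hF, zero_sub, norm_neg] at this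
  rw [h1]
  refine (norm_add_le _ _).trans ?_
  have h3 := norm_mul_le E (F - truncate T F)
  have h4 : ‖ω (truncate T F) • E‖ ≤ ‖F - truncate T F‖ * ‖E‖ := by
    rw [norm_smul]; gcongr
  linarith

theorem hasBoundedApproximateIdentity_of_eventually
    (h : ∀ᶠ i in cofinite, ‖IsNormalizedCharacter.idempotent (f i)‖ = 1) :
    HasBoundedApproximateIdentity (RingHom.ker ω) := by
  classical
  have hone : ∀ i, 1 ≤ ‖IsNormalizedCharacter.idempotent (f i)‖ := fun i => by
    have := norm_algHom_le ω (factorIdempotent hf i)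
    rw [hω, norm_one, factorIdempotent, norm_zincl] at this
    exact this
  have hfin : {i | ‖IsNormalizedCharacter.idempotent (f i)‖ ≠ 1}.Finite := h
  let C := ∏ i ∈ hfin.toFinset, ‖IsNormalizedCharacter.idempotent (f i)‖
  have hC : ∀ T : Finset I, ‖∏ i ∈ T, factorIdempotent hf i‖ ≤ C := by
    intro T
    have h1 : ‖∏ i ∈ T, factorIdempotent hf i‖ =
        ∏ i ∈ T, ‖IsNormalizedCharacter.idempotent (f i)‖ := by
      have := norm_prod_factorIdempotent_mul hf T (W := 1) fun j _ x hx => by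
        rw [OneMemClass.coe_one, one_def, delta_apply, if_neg]
        rintro rfl
        exact hx rfl
      rwa [mul_one, norm_one, mul_one] at this
    rw [h1, ← Finset.prod_filter_mul_prod_filter_not T
      fun i => ‖IsNormalizedCharacter.idempotent (f i)‖ ≠ 1]
    rw [Finset.prod_eq_one (s := T.filter fun i =>
      ¬ ‖IsNormalizedCharacter.idempotent (f i)‖ ≠ 1) fun i hi => by
        simpa using (Finset.mem_filter.1 hi).2, mul_one]
    have hsub : T.filter (fun i => ‖IsNormalizedCharacter.idempotent (f i)‖ ≠ 1) ⊆
        hfin.toFinset := fun i hi => hfin.mem_toFinset.2 (Finset.mem_filter.1 hi).2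
    change _ ≤ ∏ i ∈ hfin.toFinset, ‖IsNormalizedCharacter.idempotent (f i)‖
    rw [← Finset.prod_sdiff hsub]
    refine le_mul_of_one_le_left (Finset.prod_nonneg fun _ _ => norm_nonneg _) ?_
    exact Finset.prod_const_one.symm.le.trans
      (Finset.prod_le_prod (fun _ _ => zero_le_one) fun i _ => hone i)
  refine ⟨map (fun T : Finset I => 1 - ∏ i ∈ T, factorIdempotent hf i) atTop, inferInstance,
    ⟨1 + C, eventually_map.2 (Eventually.of_forall fun T => ⟨?_, ?_⟩)⟩, fun a ha => ?_⟩
  · rw [RingHom.mem_ker, map_sub, map_one]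
    exact sub_eq_zero.2 (algHom_prod_factorIdempotent hf hω T).symm
  · refine (norm_sub_le _ _).trans ?_
    rw [norm_one]
    gcongr
    exact hC T
  · have ha' : ω a = 0 := ha
    have key : Tendsto (fun T : Finset I => (1 - ∏ i ∈ T, factorIdempotent hf i) * a) atTop
        (𝓝 a) := by
      rw [tendsto_iff_norm_sub_tendsto_zero]
      have h0 := (tendsto_norm_sub_truncate a).const_mul (2 * C)
      rw [mul_zero] at h0
      refine squeeze_zero (fun _ => norm_nonneg _) (fun T => ?_) h0
      have h1 : (1 - ∏ i ∈ T, factorIdempotent hf i) * a - a =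
          -((∏ i ∈ T, factorIdempotent hf i) * a) := by
        rw [mul_comm, ZEllOne.mul_sub, mul_one, mul_comm a]
        abel
      rw [h1, norm_neg]
      refine (norm_prod_factorIdempotent_mul_le hf hω T ha').trans ?_
      gcongr
      exact hC T
    refine ⟨tendsto_map'_iff.2 key, tendsto_map'_iff.2 ?_⟩
    exact key.congr fun T => mul_comm _ _

theorem eventually_of_hasBoundedApproximateIdentity
    (h : HasBoundedApproximateIdentity (RingHom.ker ω)) :
    ∀ᶠ i in cofinite, ‖IsNormalizedCharacter.idempotent (f i)‖ = 1 := by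
  obtain ⟨l, hl, ⟨C, hC⟩, hlim⟩ := h
  by_contra hinf
  have hinf' : {i | ‖IsNormalizedCharacter.idempotent (f i)‖ ≠ 1}.Infinite := hinf
  obtain ⟨n, hn⟩ := pow_unbounded_of_one_lt (2 + C) (by norm_num : (1 : ℝ) < 1 + 1 / 1000)
  obtain ⟨T, hT, hTn⟩ := hinf'.exists_subset_card_eq n
  have hbig : 2 + C < ∏ i ∈ T, ‖IsNormalizedCharacter.idempotent (f i)‖ := by
    refine hn.trans_le ?_
    rw [← hTn, ← Finset.prod_const]
    refine Finset.prod_le_prod (fun _ _ => by norm_num) fun i hi => ?_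
    have hN := (hf i).sum_normSq_pos
    by_contra! hlt
    refine hT hi ?_
    rw [(hf i).norm_idempotent, inv_mul_lt_iff₀ hN] at hlt
    have heq := (hf i).sum_norm_eq_of_le (by linarith)
    rw [(hf i).norm_idempotent, heq, inv_mul_cancel₀ hN.ne']
  set E := ∏ i ∈ T, factorIdempotent hf i with hE
  have hEω : ω E = 1 := algHom_prod_factorIdempotent hf hω T
  have hmem : 1 - E ∈ RingHom.ker ω := by
    rw [RingHom.mem_ker, map_sub, map_one]
    exact sub_eq_zero.2 hEω.symm
  have h1 := (tendsto_iff_norm_sub_tendsto_zero.1 (hlim _ hmem).1).eventually_lt_const one_pos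
  obtain ⟨u, ⟨hu, huC⟩, hu1⟩ := (hC.and h1).exists
  have hu0 : ω u = 0 := hu
  have h2 := prod_norm_le_norm_mul hf hω T (v := 1 - u) (by rw [map_sub, map_one, hu0, sub_zero])
  have h3 : E * (1 - u) = (1 - u) + (u * (1 - E) - (1 - E)) := by
    rw [ZEllOne.mul_sub, ZEllOne.mul_sub, mul_one, mul_one, mul_comm E u]
    abel
  rw [← hE, h3] at h2
  have h4 := norm_add_le (1 - u) (u * (1 - E) - (1 - E))
  have h5 := norm_sub_le 1 u
  rw [norm_one] at h5
  linarith

end BoundedApproximateIdentity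

theorem IsIrreducibleCharacter.norm_idempotent_eq_one_iff {Γ : Type*} [Group Γ] [Fintype Γ]
    {χ : Γ → ℂ} (hχ : IsIrreducibleCharacter χ) :
    ‖IsNormalizedCharacter.idempotent fun x => (χ 1)⁻¹ * χ x‖ = 1 ↔
      χ 1 * ((∑ x, ‖χ x‖ : ℝ) : ℂ) = (Fintype.card Γ : ℂ) := by
  have hf := hχ.isNormalizedCharacter
  obtain ⟨d, hd, h1⟩ := hχ.exists_degree
  have hd0 : (d : ℝ) ≠ 0 := Nat.cast_ne_zero.2 hd.ne'
  have hdc : (d : ℂ) ≠ 0 := Nat.cast_ne_zero.2 hd.ne'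
  have hcard : (d : ℝ) ^ 2 * ∑ x, ‖(χ 1)⁻¹ * χ x‖ ^ 2 = Fintype.card Γ := by
    have h2 := hf.sum_mul_inv_eq
    have h3 : ∑ x, (χ 1)⁻¹ * χ x * ((χ 1)⁻¹ * χ x⁻¹) =
        ((d : ℂ) ^ 2)⁻¹ * (Fintype.card Γ : ℂ) := by
      rw [← hχ.sum_mul_inv, Finset.mul_sum, h1]
      refine Finset.sum_congr rfl fun x _ => ?_
      field_simp
    rw [h3, inv_mul_eq_iff_eq_mul₀ (pow_ne_zero 2 hdc)] at h2
    exact_mod_cast h2.symm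
  have hsum : ∑ x, ‖χ x‖ = d * ∑ x, ‖(χ 1)⁻¹ * χ x‖ := by
    rw [Finset.mul_sum]
    refine Finset.sum_congr rfl fun x _ => ?_
    rw [norm_mul, norm_inv, h1, Complex.norm_natCast, mul_inv_cancel_left₀ hd0]
  rw [hf.norm_idempotent, inv_mul_eq_iff_eq_mul₀ hf.sum_normSq_pos.ne', mul_one]
  have h4 : χ 1 * ((∑ x, ‖χ x‖ : ℝ) : ℂ) = (Fintype.card Γ : ℂ) ↔
      (d : ℝ) * ∑ x, ‖χ x‖ = Fintype.card Γ := by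
    rw [h1]
    exact_mod_cast Iff.rfl
  rw [h4, hsum, ← hcard, ← mul_assoc, ← sq, mul_right_inj' (pow_ne_zero 2 hd0)]

end

theorem theorem320 {I : Type*} {G : I → Type*} [∀ i, Group (G i)] [∀ i, Fintype (G i)]
    (ω : ZEllOne (RDP G) →ₐ[ℂ] ℂ) :
    (∃! χ : ∀ i, G i → ℂ, FamilyCorresponds ω χ) ∧
    ∀ χ : ∀ i, G i → ℂ, FamilyCorresponds ω χ →
      (HasBoundedApproximateIdentity (RingHom.ker ω) ↔
        ∀ᶠ i in cofinite,
          χ i 1 * ((∑ x : G i, ‖χ i x‖ : ℝ) : ℂ) = (Fintype.card (G i) : ℂ)) := by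
  refine ⟨?_, fun χ hχ => ?_⟩
  · choose χ hχ using fun i => exists_characterCorresponds (ω.comp (RDP.zincl i))
    exact ⟨χ, hχ, fun χ' hχ' => funext fun i => (hχ' i).unique (hχ i)⟩
  · have hf : ∀ i, IsNormalizedCharacter fun x => (χ i 1)⁻¹ * χ i x :=
      fun i => (hχ i).1.isNormalizedCharacter
    have hω : ∀ i, ω (factorIdempotent hf i) = 1 := by
      intro i
      have h := (hχ i).2 ⟨_, (hf i).idempotent_mem_center⟩
      rw [AlgHom.comp_apply] at h
      refine h.trans ?_
      simp only [IsNormalizedCharacter.idempotent_apply, mul_assoc]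
      have h1 := (hf i).sum_mul_inv_eq
      simp only [mul_assoc] at h1
      rw [← Finset.mul_sum, h1,
        inv_mul_cancel₀ (Complex.ofReal_ne_zero.2 (hf i).sum_normSq_pos.ne')]
    have hiff : (∀ᶠ i in cofinite,
        χ i 1 * ((∑ x : G i, ‖χ i x‖ : ℝ) : ℂ) = (Fintype.card (G i) : ℂ)) ↔
        ∀ᶠ i in cofinite,
          ‖IsNormalizedCharacter.idempotent fun x => (χ i 1)⁻¹ * χ i x‖ = 1 :=
      eventually_congr (Eventually.of_forall fun i => (hχ i).1.norm_idempotent_eq_one_iff.symm)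
    rw [hiff]
    exact ⟨eventually_of_hasBoundedApproximateIdentity hf hω,
      hasBoundedApproximateIdentity_of_eventually hf hω⟩
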